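/- **Setting.** Fix $p>0$, $c_U\ge 1$, $\kappa\ge 1$. Let $M:\mathbb R_{\ge 0}\to\mathbb R_{\ge 0}$ be nondecreasing with $M(0)=0$ and polynomially bounded above with degree $p$ and constant $c_U$, i.e. $M(y)\le c_U (y/x)^p M(x)$ for all $y>x>0$. For $y\in\mathbb R^n$ put $\|y\|_M=\big(\sum_{i=1}^n M(|y_i|)\big)^{1/p}$. For $A\in\mathbb R^{n\times d}$, the $i$-th $M$-sensitivity is $$s_i^M(A)=\sup_{x\in\mathbb R^d,\ Ax\ne 0}\frac{M(|[Ax]_i|)}{\|Ax\|_M^{p}} .$$ The $\ell_p$ Lewis weights $w_i^p(B)$ of a matrix $B$ are the weights $w_i\ge 0$, positive exactly on the nonzero rows, such that $w_i$ is the $i$-th leverage score of $W^{1/2-1/p}B$ with $W=\mathrm{diag}(w)$. A constant factor Lewis weight approximation (with constant $\kappa$) for matrices with $d$ columns returns numbers $\tilde w_i$ with $w_i^p(B)\le\kappa\tilde w_i$ for every row $i$ and $\sum_i\tilde w_i\le\kappa d$. **Algorithm** (input $A\in\mathbb R^{n\times d}$ and $\tau$ with $1\le\tau\le n$; constants $c,\theta>0$).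 Initialize $\tilde s_i=2\tau/n$ for all $i\in[n]$. For each $r=1,\dots,\lceil\log_2(n/\tau)\rceil$, repeat $\lceil c\log n\rceil$ times: hash the rows of $A$ independently and uniformly into $10\cdot 2^r$ buckets; compute constant factor approximations $\tilde w_i$ of the $\ell_p$ Lewis weights of the submatrix $A|_S$ of each bucket $S$; for every row $i\in S$ with $d^{\max\{0,p/2-1\}}\,\tilde w_i\ge\theta$, set $\tilde s_i\leftarrow\max\{2/2^r,\tilde s_i\}$. Output $\tilde s$. **Theorem.** There are constants $c,\theta>0$ depending only on $p,c_U,\kappa$ such that the following holds. 1. There is a constant $C$ depending only on $p,c_U,\kappa$ such that for all $M$ as above, all $n,d$, all $A\in\mathbb R^{n\times d}$, all $1\le\tau\le n$ and every constant factor (with constant $\kappa$) $\ell_p$ Lewis weight approximation procedure, with probability at least $99/100$ the output satisfies $\tilde s_i\ge s_i^M(A)$ for all $i\in[n]$ and $$\sum_{i=1}^n\tilde s_i\le C\big(d^{\max\{1,p/2\}}\log^2 n+\tau\big).$$ 2. If the Lewis weight procedure takes at most $c_0(\mathrm{nnz}(B)\log n+T)$ steps on every matrix $B$ with $d$ columns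 and at most $n$ rows, where $T=T(n,d)\geq 0$ and $c_0>0$ is a constant, then for $n\ge 2$ and $\mathrm{nnz}(A)\ge n$ (e.g. $A$ has no zero rows) the total running time of the algorithm in the unit-cost real RAM model is at most $$C'\Big(\mathrm{nnz}(A)\log^3 n+\frac{nT}{\tau}\log n\Big),$$ where $C'$ depends only on $p,c_U,\kappa,c_0$. -/

import Mathlib

open scoped NNReal

noncomputable section

/-! ### Losses, sensitivities, Lewis weights -/

/-- `M` is a loss defining an `M`-norm: `M 0 = 0`, `M` is nondecreasing, and `M` is polynomially
bounded above with degree `p` and constant `cU`, i.e. `M y / M x ≤ cU * (y / x) ^ p` for all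
`y > x > 0` (written without the division by `M x`). -/
structure IsMLoss (M : ℝ≥0 → ℝ≥0) (p cU : ℝ) : Prop where
  degree_pos : 0 < p
  one_le_const : 1 ≤ cU
  map_zero : M 0 = 0
  mono : Monotone M
  growth : ∀ x y : ℝ≥0, 0 < x → x < y → (M y : ℝ) ≤ cU * ((y : ℝ) / (x : ℝ)) ^ p * (M x : ℝ)

/-- The `M`-norm `(∑ i, M |y i|) ^ (1 / p)`, where `p` is the growth degree of `M`. -/
def mNorm (M : ℝ≥0 → ℝ≥0) (p : ℝ) {n : ℕ} (y : Fin n → ℝ) : ℝ :=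
  (∑ i, (M (Real.nnabs (y i)) : ℝ)) ^ (1 / p)

/-- The `i`-th `M`-sensitivity of `A`. -/
def mSensitivity (M : ℝ≥0 → ℝ≥0) (p : ℝ) {n d : ℕ} (A : Matrix (Fin n) (Fin d) ℝ) (i : Fin n) : ℝ :=
  sSup {t : ℝ | ∃ x : Fin d → ℝ, A.mulVec x ≠ 0 ∧
    t = (M (Real.nnabs (A.mulVec x i)) : ℝ) / mNorm M p (A.mulVec x) ^ p}

/-- The `i`-th `ℓ_p` sensitivity of `A`; for `p = 2` this is the leverage score of row `i`. -/
def lpSensitivity (p : ℝ) {n d : ℕ} (A : Matrix (Fin n) (Fin d) ℝ) (i : Fin n) : ℝ :=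
  sSup {t : ℝ | ∃ x : Fin d → ℝ, A.mulVec x ≠ 0 ∧
    t = |A.mulVec x i| ^ p / ∑ j, |A.mulVec x j| ^ p}

/-- `w` is a vector of `ℓ_p` Lewis weights of `A`: `w i` is the `i`-th leverage score of
`W ^ (1/2 - 1/p) A`, where `W = diag w`. Weights of nonzero rows have to be positive (the equation
alone has spurious solutions such as `w = 0`); weights of zero rows are `0` by the equation. -/
def IsLewisWeights (p : ℝ) {n d : ℕ} (A : Matrix (Fin n) (Fin d) ℝ) (w : Fin n → ℝ) : Prop :=
  ∀ i, (A i ≠ 0 → 0 < w i) ∧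
    w i = lpSensitivity 2 (Matrix.diagonal (fun j => w j ^ (1 / 2 - 1 / p)) * A) i

open Classical in
/-- The `ℓ_p` Lewis weights of `A`. They exist and are unique for every `p > 0`; the value `0` of
the second branch is never used. -/
def lewisWeight (p : ℝ) {n d : ℕ} (A : Matrix (Fin n) (Fin d) ℝ) : Fin n → ℝ :=
  if h : ∃ w, IsLewisWeights p A w then h.choose else 0

/-- The number of nonzero entries of row `i`. -/
def rowNnz {n d : ℕ} (A : Matrix (Fin n) (Fin d) ℝ) (i : Fin n) : ℕ :=
  {j : Fin d | A i j ≠ 0}.ncard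

/-- The number of nonzero entries of `A`. -/
def nnz {n d : ℕ} (A : Matrix (Fin n) (Fin d) ℝ) : ℕ := ∑ i, rowNnz A i

/-! ### Step-counted computations

Real RAM: arithmetic operations, comparisons, reads, writes and the draw of a uniform number from
`{1, …, B}` take one step each; matrices are stored by rows, each row as the list of its nonzero
entries. -/

/-- A computation with result `val` that takes `time` steps. -/
structure Timed (α : Type) where
  val : α
  time : ℕ

instance : Monad Timed where
  pure a := ⟨a, 0⟩
  bind x f := ⟨(f x.val).val, x.time + (f x.val).time⟩

/-- Spend `k` steps. -/
def spend (k : ℕ) : Timed Unit := ⟨(), k⟩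

/-- A subroutine for Lewis weights of matrices with `d` columns: an arbitrary procedure that takes a
matrix and returns one number per row, together with the number of steps it took. -/
abbrev LewisRoutine (d : ℕ) := (m : ℕ) → Matrix (Fin m) (Fin d) ℝ → Timed (Fin m → ℝ)

/-- On all matrices with at most `n` rows, the routine is a constant factor approximation of the
`ℓ_p` Lewis weights: the returned numbers are, up to the factor `κ`, upper bounds on the Lewis
weights, and they sum to at most `κ * d`. This holds in particular if `w i ≤ w' i` and
`∑ i, w' i ≤ κ * d`, and also if `w i / κ ≤ w' i ≤ κ * w i` for all `i`, where `w` are the Lewis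
weights (which sum to the rank) and `w'` the returned numbers. -/
def LewisRoutine.Approximates {d : ℕ} (L : LewisRoutine d) (p κ : ℝ) (n : ℕ) : Prop :=
  ∀ m ≤ n, ∀ B : Matrix (Fin m) (Fin d) ℝ,
    (∀ i, lewisWeight p B i ≤ κ * (L m B).val i) ∧ ∑ i, (L m B).val i ≤ κ * d

/-- On every matrix `B` with at most `n` rows, the routine takes at most
`c₀ * (nnz B * log n + T)` steps. -/
def LewisRoutine.RunsIn {d : ℕ} (L : LewisRoutine d) (c₀ T : ℝ) (n : ℕ) : Prop :=
  ∀ m ≤ n, ∀ B : Matrix (Fin m) (Fin d) ℝ,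
    ((L m B).time : ℝ) ≤ c₀ * ((nnz B : ℝ) * Real.log n + T)

/-! ### The algorithm -/

section Algorithm

variable {n d : ℕ}

/-- Create an array of length `n` with all entries equal to `v`. -/
def fill (n : ℕ) (v : ℝ) : Timed (Fin n → ℝ) := ⟨fun _ => v, n⟩

/-- Hash the rows into `B` buckets (lists of row indices), row `i` into bucket `h i`: create `B`
empty lists; for each row, draw its bucket and insert the index there. -/
def hashRows {B : ℕ} (h : Fin n → Fin B) : Timed (Fin B → List (Fin n)) := do
  spend B
  (List.finRange n).foldlM (fun S i => do
    spend 2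
    pure (Function.update S (h i) (i :: S (h i)))) (fun _ => [])

/-- Write out the submatrix of `A` with the rows listed in `S`, copying their nonzero entries. -/
def gather (A : Matrix (Fin n) (Fin d) ℝ) (S : List (Fin n)) :
    Timed (Matrix (Fin S.length) (Fin d) ℝ) :=
  ⟨A.submatrix S.get id, 1 + (S.map (fun i => 1 + rowNnz A i)).sum⟩

/-- Replace `s i` by `max v (s i)`: a read, a comparison and a write. -/
def raise (v : ℝ) (s : Fin n → ℝ) (i : Fin n) : Timed (Fin n → ℝ) :=
  ⟨Function.update s i (max v (s i)), 3⟩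

/-- Process a bucket `S`: approximate the Lewis weights of the rows in `S`, and raise to `v` the
bound of every row in `S` whose approximate Lewis weight, rescaled by `d ^ max 0 (p / 2 - 1)`, is
at least `θ`. (The rescaling turns Lewis weights into bounds on `ℓ_p` sensitivities; for `p ≤ 2`
the factor is `1`.) -/
def processBucket (p θ : ℝ) (L : LewisRoutine d) (A : Matrix (Fin n) (Fin d) ℝ) (v : ℝ)
    (s : Fin n → ℝ) (S : List (Fin n)) : Timed (Fin n → ℝ) := do
  let B ← gather A S
  let w ← L S.length B
  (List.finRange S.length).foldlM (fun s k => do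
    spend 3
    if θ ≤ (d : ℝ) ^ max 0 (p / 2 - 1) * w k then raise v s (S.get k) else pure s) s

/-- One round at level `r` with hash function `h`: hash the rows into `10 * 2 ^ r` buckets and
process every bucket with the value `2 / 2 ^ r`. -/
def hashRound (p θ : ℝ) (L : LewisRoutine d) (A : Matrix (Fin n) (Fin d) ℝ) (r : ℕ)
    (h : Fin n → Fin (10 * 2 ^ r)) (s : Fin n → ℝ) : Timed (Fin n → ℝ) := do
  let S ← hashRows h
  (List.finRange (10 * 2 ^ r)).foldlM (fun s b => do
    spend 1
    processBucket p θ L A (2 / 2 ^ r) s (S b)) s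

/-- The number `⌈log₂ (n / τ)⌉` of levels. -/
def levels (n : ℕ) (τ : ℝ) : ℕ := ⌈Real.logb 2 (n / τ)⌉₊

/-- The number `⌈c * log n⌉` of rounds per level. -/
def rounds (c : ℝ) (n : ℕ) : ℕ := ⌈c * Real.log n⌉₊

/-- The random choices of the algorithm: for every level `r ∈ {1, …, levels n τ}` (here `r - 1` is
the index) and every round, a hash function from the rows to `10 * 2 ^ r` buckets. -/
abbrev HashSeed (c : ℝ) (n : ℕ) (τ : ℝ) : Type :=
  (r : Fin (levels n τ)) → Fin (rounds c n) → Fin n → Fin (10 * 2 ^ ((r : ℕ) + 1))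

/-- The algorithm: start with the bounds `2 * τ / n`; for every level and every round, hash
the rows and process the buckets. -/
def sensitivityBounds (p c θ : ℝ) (L : LewisRoutine d) (A : Matrix (Fin n) (Fin d) ℝ) (τ : ℝ)
    (ω : HashSeed c n τ) : Timed (Fin n → ℝ) := do
  spend 10 -- constants and loop bounds
  let s ← fill n (2 * τ / n)
  (List.finRange (levels n τ)).foldlM (fun s (r : Fin (levels n τ)) => do
    spend 3
    (List.finRange (rounds c n)).foldlM (fun s (t : Fin (rounds c n)) => do
      spend 1
      hashRound p θ L A ((r : ℕ) + 1) (ω r t) s) s) s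

end Algorithm

end

/-!
The proof has a deterministic, a linear-algebraic and a probabilistic part.

*Lewis weights bound sensitivities.* Lewis weights exist for every `p > 0`
(`exists_isLewisWeights`): among the bases of the column space of `A`, written as matrices `V` whose
rows have `p`-th powers of norms summing to `1`, take one of largest determinant relative to a fixed
basis. The first-order condition along the perturbations `1 + t z zᵀ` says that the rows of `V`,
reweighted by the `(p - 2)`-th powers of their norms, are isotropic (`isotropic_of_max_det`), and
this is the Lewis equation for `w i = k * ‖V i‖ ^ p` with `k` the rank of `A`. No
convexity enters, so small and large `p` are treated alike. Since leverage scores sum to at most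
`d`, comparing second and `p`-th moments gives
`|(A x) i| ^ p ≤ d ^ max 0 (p / 2 - 1) * w i * ∑ j, |(A x) j| ^ p`
(`abs_mulVec_rpow_le_lewisWeight`).

*Sum of the bounds and running time.* Approximate Lewis weights sum to at most `κ * d`, so every
bucket has `O(d ^ max 1 (p / 2))` rows above the threshold, whatever the hash function; a round at
level `r` therefore adds `O(d ^ max 1 (p / 2))` to the sum, and there are `O(log² n)` rounds. The
buckets of a round partition the rows, so the costs of a round add up to
`O(nnz A * log n + 2 ^ r * (T + 1))`, and the powers `2 ^ r` form a geometric series of sum `O(n / τ)`.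

*Correctness.* Let row `i` have sensitivity `s > 2 * τ / n`, let `1 / 2 ^ r < s ≤ 2 / 2 ^ r`, and
let `x` be such that the `i`-th entry of `A x` has more than a `1 / 2 ^ r` fraction of the `M`-mass.
By Markov's inequality a random hash function into `10 * 2 ^ r` buckets puts less `M`-mass next to `i`
than `i` has itself, except with probability `1 / 10` (`card_heavy_collision_mul_le`). In that case
all other entries in the bucket are smaller than the `i`-th, and the growth of `M` bounds their
`p`-th powers, so that `i` carries at least a `1 / (1 + cU)` fraction of the `ℓ_p` mass of the bucket
(`IsMLoss.sum_rpow_abs_le`). Hence its approximate Lewis weight reaches the threshold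
`1 / (κ * (1 + cU))` and its bound is raised to `2 / 2 ^ r ≥ s`. All rounds of level `r` fail with
probability at most `n ^ (-8)`, and a union bound over the rows finishes the proof.
-/

noncomputable section

/-! ### Sensitivities as suprema -/

theorem lpSensitivity_nonneg (p : ℝ) {n d : ℕ} (A : Matrix (Fin n) (Fin d) ℝ) (i : Fin n) :
    0 ≤ lpSensitivity p A i := by
  refine Real.sSup_nonneg ?_
  rintro t ⟨x, -, rfl⟩
  positivity

theorem lpSensitivity_le {p t : ℝ} {n d : ℕ} {A : Matrix (Fin n) (Fin d) ℝ} {i : Fin n}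
    (ht : 0 ≤ t) (h : ∀ x, |A.mulVec x i| ^ p ≤ t * ∑ j, |A.mulVec x j| ^ p) :
    lpSensitivity p A i ≤ t := by
  refine Real.sSup_le ?_ ht
  rintro s ⟨x, -, rfl⟩
  exact div_le_of_le_mul₀ (by positivity) ht (h x)

theorem le_lpSensitivity (p : ℝ) {n d : ℕ} (A : Matrix (Fin n) (Fin d) ℝ) (i : Fin n)
    {x : Fin d → ℝ} (hx : A.mulVec x ≠ 0) :
    |A.mulVec x i| ^ p / ∑ j, |A.mulVec x j| ^ p ≤ lpSensitivity p A i := by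
  refine le_csSup ⟨1, ?_⟩ ⟨x, hx, rfl⟩
  rintro s ⟨y, -, rfl⟩
  refine div_le_one_of_le₀ ?_ (by positivity)
  exact Finset.single_le_sum (f := fun j => |A.mulVec y j| ^ p) (fun j _ => by positivity)
    (Finset.mem_univ i)

/-- The inequality between the entries of `A x` and their `p`-th powers that defines the
sensitivity, without division. -/
theorem abs_mulVec_rpow_le {p : ℝ} (hp : 0 < p) {n d : ℕ} (A : Matrix (Fin n) (Fin d) ℝ)
    (i : Fin n) (x : Fin d → ℝ) :
    |A.mulVec x i| ^ p ≤ lpSensitivity p A i * ∑ j, |A.mulVec x j| ^ p := by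
  by_cases hx : A.mulVec x = 0
  · simp [hx, hp.ne']
  · have hpos : 0 < ∑ j, |A.mulVec x j| ^ p := by
      obtain ⟨j, hj⟩ := Function.ne_iff.1 hx
      exact Finset.sum_pos' (fun j _ => by positivity)
        ⟨j, Finset.mem_univ _, Real.rpow_pos_of_pos (abs_pos.2 hj) p⟩
    exact (div_le_iff₀ hpos).1 (le_lpSensitivity p A i hx)

/-! ### Orthonormal bases of column spaces -/

/-- The column space of a matrix has an orthonormal basis, here the columns of `U`. -/
theorem exists_orthonormal_columns {m d : ℕ} (A : Matrix (Fin m) (Fin d) ℝ) :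
    ∃ (k : ℕ) (U : Matrix (Fin m) (Fin k) ℝ), k ≤ d ∧ U.transpose * U = 1 ∧
      (∀ x, ∃ z, A.mulVec x = U.mulVec z) ∧ ∀ z, ∃ x, U.mulVec z = A.mulVec x := by
  let f : (Fin d → ℝ) →ₗ[ℝ] EuclideanSpace ℝ (Fin m) :=
    (WithLp.linearEquiv 2 ℝ (Fin m → ℝ)).symm.toLinearMap ∘ₗ A.mulVecLin
  have hf : ∀ x i, f x i = A.mulVec x i := fun x i => rfl
  obtain ⟨b⟩ : Nonempty (OrthonormalBasis (Fin (Module.finrank ℝ (LinearMap.range f))) ℝ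
      (LinearMap.range f)) := ⟨stdOrthonormalBasis ℝ _⟩
  let U : Matrix (Fin m) (Fin (Module.finrank ℝ (LinearMap.range f))) ℝ :=
    fun i l => (b l : EuclideanSpace ℝ (Fin m)) i
  have hU : ∀ z i, U.mulVec z i = (b.repr.symm (WithLp.toLp 2 z) : EuclideanSpace ℝ (Fin m)) i := by
    intro z i
    rw [← b.sum_repr_symm]
    simp [Matrix.mulVec, dotProduct, U, mul_comm]
  refine ⟨_, U, ?_, ?_, ?_, ?_⟩
  · simpa using LinearMap.finrank_range_le f
  · ext l l'
    have h := orthonormal_iff_ite.1 b.orthonormal l l'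
    rw [Submodule.coe_inner, PiLp.inner_apply] at h
    simp only [Matrix.mul_apply, Matrix.transpose_apply, Matrix.one_apply]
    rw [← h]
    refine Finset.sum_congr rfl fun i _ => ?_
    rw [RCLike.inner_apply, conj_trivial, mul_comm]
  · intro x
    refine ⟨(b.repr ⟨f x, x, rfl⟩).ofLp, ?_⟩
    ext i
    rw [hU]
    simp [hf]
  · intro z
    obtain ⟨x, hx⟩ := (b.repr.symm (WithLp.toLp 2 z)).2
    refine ⟨x, ?_⟩
    ext i
    rw [hU, ← hx, hf]

theorem sum_mulVec_sq {m k : ℕ} {U : Matrix (Fin m) (Fin k) ℝ} (hU : U.transpose * U = 1)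
    (z : Fin k → ℝ) : ∑ i, U.mulVec z i ^ 2 = ∑ l, z l ^ 2 := by
  have h : U.mulVec z ⬝ᵥ U.mulVec z = z ⬝ᵥ z := by
    rw [Matrix.dotProduct_mulVec, Matrix.vecMul_mulVec, hU, Matrix.vecMul_one]
  simpa [dotProduct, sq] using h

theorem mulVec_sq_le {m k : ℕ} (U : Matrix (Fin m) (Fin k) ℝ) (z : Fin k → ℝ) (i : Fin m) :
    U.mulVec z i ^ 2 ≤ (∑ l, U i l ^ 2) * ∑ l, z l ^ 2 :=
  Finset.sum_mul_sq_le_sq_mul_sq Finset.univ (U i) z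

/-- Leverage scores sum to at most the number of columns: the leverage score of a row is the squared
norm of that row in an orthonormal basis of the column space. -/
theorem sum_lpSensitivity_two_le {m d : ℕ} (A : Matrix (Fin m) (Fin d) ℝ) :
    ∑ i, lpSensitivity 2 A i ≤ d := by
  obtain ⟨k, U, hk, hU, hA, -⟩ := exists_orthonormal_columns A
  have h : ∀ i, lpSensitivity 2 A i ≤ ∑ l, U i l ^ 2 := by
    intro i
    refine lpSensitivity_le (by positivity) fun x => ?_
    obtain ⟨z, hz⟩ := hA x
    simp only [Real.rpow_two, sq_abs, hz, sum_mulVec_sq hU]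
    exact mulVec_sq_le U z i
  have hcol : ∀ l, ∑ i, U i l ^ 2 = 1 := by
    intro l
    have := congrFun (congrFun hU l) l
    simpa [Matrix.mul_apply, sq] using this
  calc ∑ i, lpSensitivity 2 A i ≤ ∑ i, ∑ l, U i l ^ 2 := Finset.sum_le_sum fun i _ => h i
    _ = ∑ l, ∑ i, U i l ^ 2 := Finset.sum_comm
    _ = k := by simp [hcol]
    _ ≤ d := by exact_mod_cast hk

/-! ### Existence of Lewis weights -/

/-- The sum of the `p`-th powers of the Euclidean norms of the rows of `V`. -/
def rowPowSum (p : ℝ) {m k : ℕ} (V : Matrix (Fin m) (Fin k) ℝ) : ℝ :=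
  ∑ i, (∑ l, V i l ^ 2) ^ (p / 2)

theorem rowPowSum_nonneg (p : ℝ) {m k : ℕ} (V : Matrix (Fin m) (Fin k) ℝ) :
    0 ≤ rowPowSum p V := by
  unfold rowPowSum
  positivity

theorem rowPowSum_smul {p : ℝ} {m k : ℕ} (V : Matrix (Fin m) (Fin k) ℝ) {c : ℝ}
    (hc : 0 ≤ c) : rowPowSum p (c • V) = c ^ p * rowPowSum p V := by
  unfold rowPowSum
  rw [Finset.mul_sum]
  refine Finset.sum_congr rfl fun i _ => ?_
  have : ∑ l, (c • V) i l ^ 2 = c ^ 2 * ∑ l, V i l ^ 2 := by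
    simp [Finset.mul_sum, mul_pow]
  rw [this, Real.mul_rpow (by positivity) (by positivity), ← Real.rpow_natCast c 2,
    ← Real.rpow_mul hc]
  congr 2
  push_cast
  ring

theorem rowPowSum_pos (p : ℝ) {m k : ℕ} {V : Matrix (Fin m) (Fin k) ℝ} (hV : V ≠ 0) :
    0 < rowPowSum p V := by
  obtain ⟨i, hi⟩ := Function.ne_iff.1 hV
  obtain ⟨l, hl⟩ := Function.ne_iff.1 hi
  have h : 0 < ∑ l, V i l ^ 2 :=
    Finset.sum_pos' (fun _ _ => sq_nonneg _) ⟨l, Finset.mem_univ _, sq_pos_iff.2 hl⟩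
  exact Finset.sum_pos' (fun _ _ => by positivity)
    ⟨i, Finset.mem_univ _, Real.rpow_pos_of_pos h _⟩

/-- Among the coordinate changes `T` for which the rows of `U * T` satisfy `rowPowSum p (U * T) ≤ 1`
there is one of largest determinant, by compactness. The bound is stated in its scale-invariant
form. -/
theorem exists_max_det {p : ℝ} (hp : 0 < p) {m k : ℕ} (hk : 0 < k) {U : Matrix (Fin m) (Fin k) ℝ}
    (hU : U.transpose * U = 1) :
    ∃ T : Matrix (Fin k) (Fin k) ℝ, T.det ≠ 0 ∧ rowPowSum p (U * T) = 1 ∧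
      ∀ Q : Matrix (Fin k) (Fin k) ℝ, 0 < rowPowSum p (U * Q) →
        |Q.det| ≤ |T.det| * rowPowSum p (U * Q) ^ (k / p) := by
  let K : Set (Matrix (Fin k) (Fin k) ℝ) := {T | rowPowSum p (U * T) ≤ 1}
  have hcont : Continuous fun T : Matrix (Fin k) (Fin k) ℝ => rowPowSum p (U * T) := by
    unfold rowPowSum
    refine continuous_finsetSum _ fun i _ =>
      Continuous.rpow_const ?_ fun _ => Or.inr (by positivity)
    refine continuous_finsetSum _ fun l _ => Continuous.pow ?_ 2
    exact (continuous_const.matrix_mul continuous_id).matrix_elem i l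
  have hKc : IsCompact K := by
    have hbox : IsCompact (Set.univ.pi fun a : Fin k => Set.univ.pi fun _ : Fin k =>
        Set.Icc (-∑ i, |U i a|) (∑ i, |U i a|)) :=
      isCompact_univ_pi fun a => isCompact_univ_pi fun _ => isCompact_Icc
    refine hbox.of_isClosed_subset (isClosed_le hcont continuous_const) ?_
    intro (T : Matrix (Fin k) (Fin k) ℝ) hT a _ l _
    have hent : ∀ i : Fin m, |(U * T : Matrix (Fin m) (Fin k) ℝ) i l| ≤ 1 := by
      intro i
      have h1 : (∑ l, (U * T) i l ^ 2) ^ (p / 2) ≤ 1 :=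
        (Finset.single_le_sum (f := fun i => (∑ l, (U * T) i l ^ 2) ^ (p / 2))
          (fun _ _ => by positivity) (Finset.mem_univ i)).trans hT
      have h2 : ∑ l, (U * T) i l ^ 2 ≤ 1 := by
        by_contra! h
        exact absurd h1 (not_le.2 (Real.one_lt_rpow h (by positivity)))
      have h3 : (U * T) i l ^ 2 ≤ 1 :=
        (Finset.single_le_sum (f := fun l => (U * T) i l ^ 2)
          (fun _ _ => by positivity) (Finset.mem_univ l)).trans h2
      exact abs_le_one_iff_mul_self_le_one.2 (by rwa [← sq])
    -- `T` is recovered from `U * T` by the left inverse `Uᵀ`, so its entries are bounded.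
    have hT' : T a l = ∑ i, U i a * (U * T) i l := by
      have : T = U.transpose * (U * T) := by rw [← Matrix.mul_assoc, hU, Matrix.one_mul]
      conv_lhs => rw [this]
      simp [Matrix.mul_apply]
    change T a l ∈ Set.Icc (-∑ i, |U i a|) (∑ i, |U i a|)
    rw [Set.mem_Icc, ← abs_le, hT']
    refine (Finset.abs_sum_le_sum_abs _ _).trans (Finset.sum_le_sum fun i _ => ?_)
    rw [abs_mul]
    exact mul_le_of_le_one_right (abs_nonneg _) (hent i)
  have h0 : (0 : Matrix (Fin k) (Fin k) ℝ) ∈ K := by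
    have : (p / 2) ≠ 0 := by positivity
    simp [K, rowPowSum, this]
  obtain ⟨T, hTK, hT⟩ := hKc.exists_isMaxOn ⟨0, h0⟩
    (f := fun T => |T.det|) (by fun_prop)
  have hmax : ∀ Q : Matrix (Fin k) (Fin k) ℝ, 0 < rowPowSum p (U * Q) →
        |Q.det| ≤ |T.det| * rowPowSum p (U * Q) ^ (k / p) := by
    intro Q hQ
    set N := rowPowSum p (U * Q) with hN
    -- Rescale `Q` to the boundary of `K`.
    have hmem : (N ^ (-(1 / p))) • Q ∈ K := by
      simp only [K, Set.mem_ofPred_eq, Matrix.mul_smul]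
      rw [rowPowSum_smul _ (by positivity), ← hN, ← Real.rpow_mul hQ.le,
        show -(1 / p) * p = -1 by field_simp, Real.rpow_neg_one, inv_mul_cancel₀ hQ.ne']
    have h := hT hmem
    simp only [Set.mem_ofPred_eq, Matrix.det_smul, Fintype.card_fin, abs_mul] at h
    rw [abs_of_nonneg (by positivity), ← Real.rpow_natCast, ← Real.rpow_mul hQ.le,
      show -(1 / p) * (k : ℝ) = -(k / p) by ring, Real.rpow_neg hQ.le,
      inv_mul_le_iff₀ (Real.rpow_pos_of_pos hQ _)] at h
    linarith
  have hinj : ∀ Q : Matrix (Fin k) (Fin k) ℝ, Q.det ≠ 0 → 0 < rowPowSum p (U * Q) := by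
    intro Q hQ
    refine rowPowSum_pos p fun h => hQ ?_
    have : Q = U.transpose * (U * Q) := by rw [← Matrix.mul_assoc, hU, Matrix.one_mul]
    have : Nonempty (Fin k) := Fin.pos_iff_nonempty.1 hk
    rw [‹Q = _›, h, Matrix.mul_zero, Matrix.det_zero]
  have hdet : T.det ≠ 0 := by
    intro h
    have := hmax 1 (hinj 1 (by simp))
    simp [h] at this
    linarith
  refine ⟨T, hdet, le_antisymm hTK ?_, hmax⟩
  -- If the constraint were slack, scaling `T` up would increase the determinant.
  by_contra! hlt
  have h1 := hmax T (hinj T hdet)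
  have h2 : rowPowSum p (U * T) ^ (k / p) < 1 :=
    Real.rpow_lt_one (rowPowSum_nonneg _ _) hlt (by positivity)
  have h3 : 0 < |T.det| := abs_pos.2 hdet
  nlinarith

/-- The first-order condition at a maximizer of the determinant, taken along the rank-one
perturbations `1 + t z zᵀ`: after reweighting by the `(p - 2)`-th powers of their norms, the rows of
`V` are in isotropic position. -/
theorem isotropic_of_max_det {p : ℝ} (hp : 0 < p) {m k : ℕ} (hk : 0 < k)
    {V : Matrix (Fin m) (Fin k) ℝ} (hV : rowPowSum p V = 1)
    (hmax : ∀ Q : Matrix (Fin k) (Fin k) ℝ, 0 < rowPowSum p (V * Q) →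
        |Q.det| ≤ rowPowSum p (V * Q) ^ (k / p)) {z : Fin k → ℝ} (hz : ∑ l, z l ^ 2 = 1) :
    ∑ i, (∑ l, V i l ^ 2) ^ (p / 2 - 1) * V.mulVec z i ^ 2 = 1 / k := by
  have hk' : (0 : ℝ) < k := by exact_mod_cast hk
  set a : Fin m → ℝ := fun i => ∑ l, V i l ^ 2 with ha
  set b : Fin m → ℝ := V.mulVec z with hb
  let Q : ℝ → Matrix (Fin k) (Fin k) ℝ := fun t =>
    1 + t • Matrix.vecMulVec z z
  have hQdet : ∀ t, (Q t).det = 1 + t := by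
    intro t
    have := Matrix.det_one_add_replicateCol_mul_replicateRow (ι := Unit) (t • z) z
    rw [← Matrix.vecMulVec_eq] at this
    simp only [Q]
    rw [← Matrix.smul_vecMulVec, this, dotProduct_smul]
    simp [dotProduct, ← sq, hz]
  have hrow : ∀ t i, ∑ l, (V * Q t) i l ^ 2 = a i + (2 * t + t ^ 2) * b i ^ 2 := by
    intro t i
    have h1 : ∀ l, (V * Q t) i l = V i l + t * b i * z l := by
      intro l
      simp only [Q, Matrix.mul_add, Matrix.mul_one, Matrix.mul_smul, Matrix.add_apply,
        Matrix.smul_apply, Matrix.mul_vecMulVec, Matrix.vecMulVec_apply, smul_eq_mul, hb]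
      ring
    have h2 : ∑ l, V i l * z l = b i := rfl
    calc ∑ l, (V * Q t) i l ^ 2
        = ∑ l, (V i l ^ 2 + 2 * t * b i * (V i l * z l) + t ^ 2 * b i ^ 2 * z l ^ 2) :=
          Finset.sum_congr rfl fun l _ => by rw [h1]; ring
      _ = _ := by
        rw [Finset.sum_add_distrib, Finset.sum_add_distrib, ← Finset.mul_sum, ← Finset.mul_sum,
          h2, hz]
        ring
  have hba : ∀ i, a i = 0 → b i = 0 := by
    intro i hi
    have := mulVec_sq_le V z i
    rw [show ∑ l, V i l ^ 2 = 0 from hi, zero_mul] at this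
    exact pow_eq_zero_iff two_ne_zero |>.1 (le_antisymm this (sq_nonneg _))
  have ha0 : ∀ i, 0 ≤ a i := fun i => Finset.sum_nonneg fun _ _ => sq_nonneg _
  have hder : HasDerivAt (fun t => rowPowSum p (V * Q t))
      (∑ i, p * (a i ^ (p / 2 - 1) * b i ^ 2)) 0 := by
    simp only [rowPowSum, hrow]
    refine HasDerivAt.fun_sum fun i _ => ?_
    -- `t ^ (p / 2)` need not be differentiable at `0`, but zero rows stay zero.
    rcases (ha0 i).eq_or_lt with h | h
    · simp only [← h, hba i h.symm]
      simpa using hasDerivAt_const (0 : ℝ) ((0 : ℝ) ^ (p / 2))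
    · have h1 : HasDerivAt (fun t : ℝ => a i + (2 * t + t ^ 2) * b i ^ 2) (2 * b i ^ 2) 0 := by
        have := (((hasDerivAt_id (0 : ℝ)).const_mul 2).add
          ((hasDerivAt_id (0 : ℝ)).pow 2)).mul_const (b i ^ 2) |>.const_add (a i)
        simpa using this
      have := h1.rpow_const (p := p / 2) (Or.inl (by simpa using h.ne'))
      refine this.congr_deriv ?_
      norm_num
      ring
  have hN0 : rowPowSum p (V * Q 0) = 1 := by simpa [Q] using hV
  have hlog : HasDerivAt (fun t => k * Real.log (rowPowSum p (V * Q t)) - p * Real.log (1 + t))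
      (k * ∑ i, p * (a i ^ (p / 2 - 1) * b i ^ 2) - p) 0 := by
    have h1 := (hder.log (by rw [hN0]; exact one_ne_zero)).const_mul (k : ℝ)
    have h2 := (((hasDerivAt_id (0 : ℝ)).const_add 1).log (by simp)).const_mul p
    refine (h1.sub h2).congr_deriv ?_
    rw [hN0]
    simp
  -- The logarithm of the determinant bound at `Q t`; equality holds at `t = 0`.
  have hmin : IsLocalMin
      (fun t => k * Real.log (rowPowSum p (V * Q t)) - p * Real.log (1 + t)) 0 := by
    have e1 : ∀ᶠ t in nhds (0 : ℝ), 0 < rowPowSum p (V * Q t) :=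
      hder.continuousAt.eventually (lt_mem_nhds (by simp only [hN0]; exact one_pos))
    have e2 : ∀ᶠ t in nhds (0 : ℝ), -1 < t := lt_mem_nhds (by norm_num)
    filter_upwards [e1, e2] with t ht1 ht2
    have h := hmax (Q t) ht1
    have ht3 : 0 < 1 + t := by linarith
    rw [hQdet, abs_of_pos ht3] at h
    have h' := Real.log_le_log ht3 h
    rw [Real.log_rpow ht1, div_mul_eq_mul_div, le_div_iff₀ hp] at h'
    simp only [hN0, Real.log_one, add_zero, mul_zero, sub_zero]
    linarith
  have h := hmin.hasDerivAt_eq_zero hlog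
  rw [← Finset.mul_sum] at h
  rw [eq_div_iff hk'.ne']
  have h' : p * ((∑ i, a i ^ (p / 2 - 1) * b i ^ 2) * k - 1) = 0 := by linarith
  have := (mul_eq_zero.1 h').resolve_left hp.ne'
  linarith

theorem diagonal_mul_mulVec {m d : ℕ} (v : Fin m → ℝ) (A : Matrix (Fin m) (Fin d) ℝ)
    (x : Fin d → ℝ) (i : Fin m) :
    (Matrix.diagonal v * A).mulVec x i = v i * A.mulVec x i := by
  rw [← Matrix.mulVec_mulVec, Matrix.mulVec_diagonal]

theorem rpow_half_sub_sq {p w : ℝ} (hw : 0 ≤ w) :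
    (w ^ (1 / 2 - 1 / p)) ^ 2 = w ^ (1 - 2 / p) := by
  rw [← Real.rpow_natCast, ← Real.rpow_mul hw]
  congr 1
  push_cast
  ring

/-- Lewis weights exist for every `p > 0`: if `V` spans the column space of `A` and is in the
isotropic position given by a maximal determinant, then the Lewis weights of `A` are the `p`-th
powers of the norms of the rows of `V`, up to a common factor. -/
theorem exists_isLewisWeights {p : ℝ} (hp : 0 < p) {m d : ℕ} (A : Matrix (Fin m) (Fin d) ℝ) :
    ∃ w, IsLewisWeights p A w := by
  obtain ⟨k, U, -, hU, hAU, hUA⟩ := exists_orthonormal_columns A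
  have hrow0 : ∀ i, (∀ x, A.mulVec x i = 0) → A i = 0 := by
    intro i h
    ext l
    simpa using h (Pi.single l 1)
  rcases Nat.eq_zero_or_pos k with rfl | hk
  · have hA : ∀ x, A.mulVec x = 0 := by
      intro x
      obtain ⟨z, hz⟩ := hAU x
      rw [hz]
      ext i
      simp [Matrix.mulVec, dotProduct]
    refine ⟨0, fun i => ⟨fun h => absurd (hrow0 i fun x => by simp [hA]) h, ?_⟩⟩
    refine le_antisymm (lpSensitivity_nonneg _ _ _) (lpSensitivity_le le_rfl fun x => ?_)
    simp [diagonal_mul_mulVec, hA]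
  obtain ⟨T, hT, hN, hmax⟩ := exists_max_det hp hk hU
  have hTu : IsUnit T.det := isUnit_iff_ne_zero.2 hT
  have hk' : (0 : ℝ) < k := by exact_mod_cast hk
  set V := U * T with hV
  have hAV : ∀ x, ∃ z, A.mulVec x = V.mulVec z := by
    intro x
    obtain ⟨z, hz⟩ := hAU x
    refine ⟨T⁻¹.mulVec z, ?_⟩
    rw [hz, Matrix.mulVec_mulVec, hV, Matrix.mul_assoc, Matrix.mul_nonsing_inv _ hTu,
      Matrix.mul_one]
  have hVA : ∀ z, ∃ x, V.mulVec z = A.mulVec x := by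
    intro z
    rw [hV, ← Matrix.mulVec_mulVec]
    exact hUA _
  have hmaxV : ∀ Q : Matrix (Fin k) (Fin k) ℝ, 0 < rowPowSum p (V * Q) →
      |Q.det| ≤ rowPowSum p (V * Q) ^ (k / p) := by
    intro Q hQ
    rw [hV, Matrix.mul_assoc] at hQ ⊢
    have h := hmax _ hQ
    rw [Matrix.det_mul, abs_mul] at h
    exact le_of_mul_le_mul_left h (abs_pos.2 hT)
  set a : Fin m → ℝ := fun i => ∑ l, V i l ^ 2 with ha
  have ha0 : ∀ i, 0 ≤ a i := fun i => Finset.sum_nonneg fun _ _ => sq_nonneg _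
  have hiso : ∀ z : Fin k → ℝ,
      ∑ i, a i ^ (p / 2 - 1) * V.mulVec z i ^ 2 = (∑ l, z l ^ 2) / k := by
    intro z
    have hs0 : 0 ≤ ∑ l, z l ^ 2 := Finset.sum_nonneg fun _ _ => sq_nonneg _
    rcases hs0.eq_or_lt with h | h
    · have hz : z = 0 := by
        ext l
        have := (Finset.sum_eq_zero_iff_of_nonneg fun l _ => sq_nonneg (z l)).1 h.symm l
          (Finset.mem_univ l)
        simpa using this
      simp [hz]
    · set r := Real.sqrt (∑ l, z l ^ 2) with hr
      have hr0 : 0 < r := Real.sqrt_pos.2 h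
      have hr2 : r ^ 2 = ∑ l, z l ^ 2 := Real.sq_sqrt h.le
      have h1 := isotropic_of_max_det hp hk hN hmaxV (z := r⁻¹ • z) (by
        simp only [Pi.smul_apply, smul_eq_mul, mul_pow, ← Finset.mul_sum]
        rw [← hr2]
        field_simp)
      simp only [Matrix.mulVec_smul, Pi.smul_apply, smul_eq_mul, mul_pow] at h1
      rw [← hr2, div_eq_mul_one_div (r ^ 2), ← h1, Finset.mul_sum]
      refine Finset.sum_congr rfl fun i _ => ?_
      rw [ha]
      field_simp
  have hw0 : ∀ i, 0 ≤ (k : ℝ) * a i ^ (p / 2) := fun i =>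
    mul_nonneg hk'.le (Real.rpow_nonneg (ha0 i) _)
  -- The weights are `w i = k * ‖V i‖ ^ p`, with the norm expressed through its square `a i`.
  have hpow : ∀ i, ((k * a i ^ (p / 2)) ^ (1 / 2 - 1 / p)) ^ 2
      = (k : ℝ) ^ (1 - 2 / p) * a i ^ (p / 2 - 1) := by
    intro i
    rw [rpow_half_sub_sq (hw0 i), Real.mul_rpow hk'.le (Real.rpow_nonneg (ha0 i) _),
      ← Real.rpow_mul (ha0 i)]
    congr 2
    field_simp
  have hC : 0 < (k : ℝ) ^ (1 - 2 / p) := Real.rpow_pos_of_pos hk' _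
  refine ⟨fun i => k * a i ^ (p / 2), fun i => ⟨fun hi => ?_, ?_⟩⟩
  · have : 0 < a i := by
      refine (ha0 i).lt_of_ne fun h => hi (hrow0 i fun x => ?_)
      obtain ⟨z, hz⟩ := hAV x
      have h2 := mulVec_sq_le V z i
      rw [show ∑ l, V i l ^ 2 = 0 from h.symm, zero_mul] at h2
      rw [hz]
      exact pow_eq_zero_iff two_ne_zero |>.1 (le_antisymm h2 (sq_nonneg _))
    exact mul_pos hk' (Real.rpow_pos_of_pos this _)
  have hsum : ∀ x z, A.mulVec x = V.mulVec z →
      ∑ j, |(Matrix.diagonal (fun j => (k * a j ^ (p / 2)) ^ (1 / 2 - 1 / p)) * A).mulVec x j|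
        ^ (2 : ℝ) = (k : ℝ) ^ (1 - 2 / p) * ((∑ l, z l ^ 2) / k) := by
    intro x z hz
    rw [← hiso z, Finset.mul_sum]
    refine Finset.sum_congr rfl fun j _ => ?_
    rw [diagonal_mul_mulVec, Real.rpow_two, sq_abs, mul_pow, hpow, hz, mul_assoc]
  have hent : ∀ x z, A.mulVec x = V.mulVec z →
      |(Matrix.diagonal (fun j => (k * a j ^ (p / 2)) ^ (1 / 2 - 1 / p)) * A).mulVec x i|
        ^ (2 : ℝ) = (k : ℝ) ^ (1 - 2 / p) * (a i ^ (p / 2 - 1) * V.mulVec z i ^ 2) := by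
    intro x z hz
    rw [diagonal_mul_mulVec, Real.rpow_two, sq_abs, mul_pow, hpow, hz, mul_assoc]
  beta_reduce
  refine le_antisymm ?_ (lpSensitivity_le (hw0 i) fun x => ?_)
  · rcases (ha0 i).eq_or_lt with h | h
    · rw [← h, Real.zero_rpow (by positivity), mul_zero]
      exact lpSensitivity_nonneg _ _ _
    -- The supremum is attained at the `i`-th row of `V`.
    · obtain ⟨x, hx⟩ := hVA (V i)
      have hb : V.mulVec (V i) i = a i := by
        simp [Matrix.mulVec, dotProduct, ha, sq]
      have h1 := abs_mulVec_rpow_le (p := 2) two_pos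
        (Matrix.diagonal (fun j => (k * a j ^ (p / 2)) ^ (1 / 2 - 1 / p)) * A) i x
      rw [hsum x _ hx.symm, hent x _ hx.symm, hb] at h1
      have h2 : a i ^ (p / 2 - 1) * a i = a i ^ (p / 2) := by
        rw [← Real.rpow_add_one h.ne', sub_add_cancel]
      have h3 : (k : ℝ) ^ (1 - 2 / p) * (a i / k) * (k * a i ^ (p / 2)) ≤
          (k : ℝ) ^ (1 - 2 / p) * (a i / k) *
          lpSensitivity 2 (Matrix.diagonal
            (fun j => (k * a j ^ (p / 2)) ^ (1 / 2 - 1 / p)) * A) i := by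
        calc (k : ℝ) ^ (1 - 2 / p) * (a i / k) * (k * a i ^ (p / 2))
            = (k : ℝ) ^ (1 - 2 / p) * (a i ^ (p / 2 - 1) * a i ^ 2) := by
              rw [← h2]; field_simp
          _ ≤ _ := h1
          _ = _ := by simp only [ha]; ring
      exact le_of_mul_le_mul_left h3 (by positivity)
  · obtain ⟨z, hz⟩ := hAV x
    rw [hsum x z hz, hent x z hz]
    have h1 : V.mulVec z i ^ 2 ≤ a i * ∑ l, z l ^ 2 := mulVec_sq_le V z i
    rcases (ha0 i).eq_or_lt with h | h
    · rw [← h, zero_mul] at h1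
      rw [le_antisymm h1 (sq_nonneg _), mul_zero, mul_zero, ← h, Real.zero_rpow (by positivity)]
      simp
    · have h2 : a i ^ (p / 2 - 1) * a i = a i ^ (p / 2) := by
        rw [← Real.rpow_add_one h.ne', sub_add_cancel]
      calc (k : ℝ) ^ (1 - 2 / p) * (a i ^ (p / 2 - 1) * V.mulVec z i ^ 2)
          ≤ (k : ℝ) ^ (1 - 2 / p) * (a i ^ (p / 2 - 1) * (a i * ∑ l, z l ^ 2)) := by gcongr
        _ = k * a i ^ (p / 2) * ((k : ℝ) ^ (1 - 2 / p) * ((∑ l, z l ^ 2) / k)) := by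
          rw [← h2]; field_simp

theorem isLewisWeights_lewisWeight {p : ℝ} (hp : 0 < p) {m d : ℕ}
    (A : Matrix (Fin m) (Fin d) ℝ) : IsLewisWeights p A (lewisWeight p A) := by
  have h := exists_isLewisWeights hp A
  rw [lewisWeight, dif_pos h]
  exact h.choose_spec

theorem lewisWeight_nonneg {p : ℝ} (hp : 0 < p) {m d : ℕ} (A : Matrix (Fin m) (Fin d) ℝ)
    (i : Fin m) : 0 ≤ lewisWeight p A i := by
  rw [(isLewisWeights_lewisWeight hp A i).2]
  exact lpSensitivity_nonneg _ _ _

/-! ### Lewis weights bound `ℓ_p` sensitivities -/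

/-- The comparison of the weighted second moment with the weighted `p`-th moment. For `p ≤ 2` the
bound `y i ^ 2 ≤ V` on each value is used to trade `y ^ 2` for `y ^ p`; for `p > 2` it is Hölder's
inequality with total mass at most `d`. -/
theorem rpow_second_moment_le {p : ℝ} (hp : 0 < p) {m d : ℕ} {w y : Fin m → ℝ}
    (hw : ∀ i, 0 ≤ w i) (hy : ∀ i, 0 ≤ y i) (hd : ∑ i, w i ≤ d)
    (hle : ∀ i, y i ^ 2 ≤ ∑ j, w j * y j ^ 2) :
    (∑ j, w j * y j ^ 2) ^ (p / 2) ≤ (d : ℝ) ^ max 0 (p / 2 - 1) * ∑ j, w j * y j ^ p := by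
  set V := ∑ j, w j * y j ^ 2 with hV
  have hV0 : 0 ≤ V := Finset.sum_nonneg fun j _ => mul_nonneg (hw j) (sq_nonneg _)
  have hS0 : 0 ≤ ∑ j, w j * y j ^ p :=
    Finset.sum_nonneg fun j _ => mul_nonneg (hw j) (Real.rpow_nonneg (hy j) _)
  have hd0 : (0 : ℝ) ≤ ∑ i, w i := Finset.sum_nonneg fun i _ => hw i
  rcases le_or_gt p 2 with h2 | h2
  · rw [max_eq_left (by linarith), Real.rpow_zero, one_mul]
    rcases hV0.eq_or_lt with h | h
    · rw [← h, Real.zero_rpow (by positivity)]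
      exact hS0
    have key : V ≤ V ^ (1 - p / 2) * ∑ j, w j * y j ^ p := by
      conv_lhs => rw [hV]
      rw [Finset.mul_sum]
      refine Finset.sum_le_sum fun j _ => ?_
      rcases (hy j).eq_or_lt with hj | hj
      · simp [← hj, hp.ne']
      have h3 : y j ^ 2 = (y j ^ 2) ^ (1 - p / 2) * y j ^ p := by
        rw [← Real.rpow_natCast, ← Real.rpow_mul hj.le, ← Real.rpow_add hj]
        congr 1
        push_cast
        ring
      have h4 : (y j ^ 2) ^ (1 - p / 2) ≤ V ^ (1 - p / 2) :=
        Real.rpow_le_rpow (sq_nonneg _) (hle j) (by linarith)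
      calc w j * y j ^ 2 = w j * ((y j ^ 2) ^ (1 - p / 2) * y j ^ p) := by rw [← h3]
        _ ≤ w j * (V ^ (1 - p / 2) * y j ^ p) := by
          have := hw j
          gcongr
        _ = _ := by ring
    have h5 : V ^ (p / 2) * V ^ (1 - p / 2) = V := by
      rw [← Real.rpow_add h]
      simp
    have h6 : 0 < V ^ (1 - p / 2) := Real.rpow_pos_of_pos h _
    nlinarith
  · rw [max_eq_right (by linarith)]
    have hH := Real.inner_le_weight_mul_Lp_of_nonneg Finset.univ (p := p / 2) (by linarith) w
      (fun j => y j ^ 2) hw fun j => sq_nonneg _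
    have h3 : ∀ j, (y j ^ 2) ^ (p / 2) = y j ^ p := by
      intro j
      rw [← Real.rpow_natCast, ← Real.rpow_mul (hy j)]
      congr 1
      push_cast
      ring
    simp only [h3] at hH
    have h4 := Real.rpow_le_rpow hV0 hH (z := p / 2) (by positivity)
    rw [Real.mul_rpow (by positivity) (by positivity), ← Real.rpow_mul hd0, ← Real.rpow_mul hS0,
      inv_mul_cancel₀ (by positivity), Real.rpow_one,
      show (1 - (p / 2)⁻¹) * (p / 2) = p / 2 - 1 by field_simp] at h4
    refine h4.trans (mul_le_mul_of_nonneg_right ?_ hS0)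
    exact Real.rpow_le_rpow hd0 hd (by linarith)

/-- Lewis weights, rescaled by `d ^ max 0 (p / 2 - 1)`, bound `ℓ_p` sensitivities. -/
theorem abs_mulVec_rpow_le_lewisWeight {p : ℝ} (hp : 0 < p) {m d : ℕ}
    (A : Matrix (Fin m) (Fin d) ℝ) (x : Fin d → ℝ) (i : Fin m) :
    |A.mulVec x i| ^ p ≤
      (d : ℝ) ^ max 0 (p / 2 - 1) * lewisWeight p A i * ∑ j, |A.mulVec x j| ^ p := by
  have hLW := isLewisWeights_lewisWeight hp A
  have hw := lewisWeight_nonneg hp A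
  set w := lewisWeight p A with hwdef
  have hd : ∑ i, w i ≤ d := by
    rw [Finset.sum_congr rfl fun i _ => (hLW i).2]
    exact sum_lpSensitivity_two_le _
  have hpos : ∀ j, A.mulVec x j ≠ 0 → 0 < w j := fun j hj => (hLW j).1 fun h => hj (by
    simp [Matrix.mulVec, h])
  let y : Fin m → ℝ := fun j => |A.mulVec x j| / w j ^ (1 / p)
  have hy : ∀ j, 0 ≤ y j := fun j => div_nonneg (abs_nonneg _) (Real.rpow_nonneg (hw j) _)
  -- In terms of `y`, the entries of the reweighted matrix are `√(w j) * y j`.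
  have hent : ∀ j, |(Matrix.diagonal (fun j => w j ^ (1 / 2 - 1 / p)) * A).mulVec x j| ^ (2 : ℝ)
      = w j * y j ^ 2 := by
    intro j
    rw [diagonal_mul_mulVec, Real.rpow_two, sq_abs, mul_pow, rpow_half_sub_sq (hw j)]
    by_cases hj : A.mulVec x j = 0
    · simp [y, hj]
    · have := hpos j hj
      simp only [y]
      rw [div_pow, sq_abs, ← Real.rpow_natCast (w j ^ (1 / p)), ← Real.rpow_mul (hw j),
        Real.rpow_sub this, Real.rpow_one]
      rw [show 1 / p * ((2 : ℕ) : ℝ) = 2 / p by push_cast; ring]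
      ring
  have hpe : ∀ j, w j * y j ^ p = |A.mulVec x j| ^ p := by
    intro j
    by_cases hj : A.mulVec x j = 0
    · simp [y, hj, hp.ne']
    · have := hpos j hj
      simp only [y]
      rw [Real.div_rpow (abs_nonneg _) (Real.rpow_nonneg (hw j) _), ← Real.rpow_mul (hw j),
        one_div_mul_cancel hp.ne', Real.rpow_one]
      field_simp
  have hle : ∀ j, y j ^ 2 ≤ ∑ j, w j * y j ^ 2 := by
    intro j
    by_cases hj : A.mulVec x j = 0
    · have : y j = 0 := by simp [y, hj]
      rw [this, zero_pow two_ne_zero]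
      exact Finset.sum_nonneg fun j _ => mul_nonneg (hw j) (sq_nonneg _)
    · have h := abs_mulVec_rpow_le (p := 2) two_pos
        (Matrix.diagonal (fun j => w j ^ (1 / 2 - 1 / p)) * A) j x
      rw [← (hLW j).2, hent] at h
      simp only [hent] at h
      exact le_of_mul_le_mul_left h (hpos j hj)
  have hmain := rpow_second_moment_le hp hw hy hd hle
  have hyi : y i ^ p ≤ (∑ j, w j * y j ^ 2) ^ (p / 2) := by
    have := Real.rpow_le_rpow (sq_nonneg _) (hle i) (z := p / 2) (by positivity)
    rwa [← Real.rpow_natCast, ← Real.rpow_mul (hy i),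
      show ((2 : ℕ) : ℝ) * (p / 2) = p by push_cast; ring] at this
  rw [← hpe i]
  calc w i * y i ^ p ≤ w i * ((d : ℝ) ^ max 0 (p / 2 - 1) * ∑ j, w j * y j ^ p) :=
        mul_le_mul_of_nonneg_left (hyi.trans hmain) (hw i)
    _ = _ := by simp only [hpe]; ring

/-! ### Loops -/

theorem foldlM_val {α β : Type} (f : β → α → Timed β) (l : List α) (s : β) :
    (l.foldlM f s).val = l.foldl (fun s a => (f s a).val) s := by
  induction l generalizing s with
  | nil => rfl
  | cons a l ih =>
    rw [List.foldlM_cons, List.foldl_cons, ← ih]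
    rfl

theorem foldlM_time_le {α β : Type} (f : β → α → Timed β) (g : α → ℝ) (l : List α)
    (h : ∀ s, ∀ a ∈ l, ((f s a).time : ℝ) ≤ g a) (s : β) :
    ((l.foldlM f s).time : ℝ) ≤ (l.map g).sum := by
  induction l generalizing s with
  | nil => exact (Nat.cast_zero (R := ℝ)).le
  | cons a l ih =>
    rw [List.foldlM_cons, List.map_cons, List.sum_cons]
    refine le_trans (le_of_eq (Nat.cast_add _ _)) ?_
    exact add_le_add (h s a (by simp)) (ih (fun s b hb => h s b (by simp [hb])) _)

theorem foldlM_finRange_time_le {β : Type} {n : ℕ} (f : β → Fin n → Timed β) (g : Fin n → ℝ)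
    (h : ∀ s a, ((f s a).time : ℝ) ≤ g a) (s : β) :
    (((List.finRange n).foldlM f s).time : ℝ) ≤ ∑ i, g i := by
  rw [Fin.sum_univ_def]
  exact foldlM_time_le f g _ (fun s a _ => h s a) s

theorem le_foldl {α β : Type*} [Preorder β] {f : β → α → β} (hf : ∀ s a, s ≤ f s a) (l : List α)
    (s : β) : s ≤ l.foldl f s := by
  induction l generalizing s with
  | nil => exact le_rfl
  | cons a l ih => exact (hf s a).trans (ih _)

theorem le_foldl_apply {α ι : Type*} {f : (ι → ℝ) → α → ι → ℝ} (hf : ∀ s a, s ≤ f s a)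
    {l : List α} {a : α} (ha : a ∈ l) {v : ℝ} {i : ι} (hv : ∀ s, v ≤ f s a i) (s : ι → ℝ) :
    v ≤ l.foldl f s i := by
  induction l generalizing s with
  | nil => simp at ha
  | cons b l ih =>
    rcases List.mem_cons.1 ha with rfl | h
    · exact (hv s).trans (le_foldl hf l _ i)
    · exact ih h _

theorem sum_foldl_le {α ι : Type*} [Fintype ι] {f : (ι → ℝ) → α → ι → ℝ} (hf : ∀ s a, s ≤ f s a)
    {g : α → ℝ} (hg : ∀ s, 0 ≤ s → ∀ a, ∑ i, f s a i ≤ ∑ i, s i + g a) (l : List α)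
    {s : ι → ℝ} (hs : 0 ≤ s) : ∑ i, l.foldl f s i ≤ ∑ i, s i + (l.map g).sum := by
  induction l generalizing s with
  | nil => simp
  | cons a l ih =>
    have h1 := ih (hs.trans (hf s a))
    have h2 := hg s hs a
    rw [List.foldl_cons, List.map_cons, List.sum_cons]
    linarith

theorem sum_foldl_finRange_le {ι : Type*} [Fintype ι] {n : ℕ} {f : (ι → ℝ) → Fin n → ι → ℝ}
    (hf : ∀ s a, s ≤ f s a) {g : Fin n → ℝ}
    (hg : ∀ s, 0 ≤ s → ∀ a, ∑ i, f s a i ≤ ∑ i, s i + g a) {s : ι → ℝ} (hs : 0 ≤ s) :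
    ∑ i, (List.finRange n).foldl f s i ≤ ∑ i, s i + ∑ a, g a := by
  rw [Fin.sum_univ_def g]
  exact sum_foldl_le hf hg _ hs

/-! ### Buckets -/

section Buckets

variable {n d B : ℕ}

/-- Bucket `b` lists the rows with hash value `b`; insertion at the front reverses their order. -/
theorem hashRows_val (h : Fin n → Fin B) (b : Fin B) :
    (hashRows h).val b = (List.finRange n).reverse.filter (fun i => h i = b) := by
  have key : ∀ (l : List (Fin n)) (S : Fin B → List (Fin n)),
      (l.foldl (fun S i => Function.update S (h i) (i :: S (h i))) S) b =
        l.reverse.filter (fun i => h i = b) ++ S b := by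
    intro l
    induction l with
    | nil => simp
    | cons a l ih =>
      intro S
      rw [List.foldl_cons, ih, List.reverse_cons, List.filter_append, List.append_assoc]
      congr 1
      by_cases hb : h a = b
      · subst hb
        simp
      · simp [hb, Function.update_of_ne (Ne.symm hb)]
  have h1 := key (List.finRange n) fun _ => []
  rw [List.append_nil] at h1
  rw [← h1]
  have heq : (hashRows h).val = ((List.finRange n).foldlM (fun S i => (do
      spend 2
      pure (Function.update S (h i) (i :: S (h i))) : Timed (Fin B → List (Fin n))))
      fun _ => []).val := rfl
  rw [heq, foldlM_val]
  rfl

theorem hashRows_time_le (h : Fin n → Fin B) : ((hashRows h).time : ℝ) ≤ B + 2 * n := by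
  have h1 := foldlM_finRange_time_le (n := n) (fun (S : Fin B → List (Fin n)) i =>
    (do spend 2; pure (Function.update S (h i) (i :: S (h i))) : Timed (Fin B → List (Fin n))))
    (fun _ => 2) (fun S i => le_of_eq (by change ((2 + 0 : ℕ) : ℝ) = 2; norm_num)) (fun _ => [])
  refine (le_of_eq (Nat.cast_add _ _)).trans (add_le_add (le_of_eq rfl) (h1.trans ?_))
  simp [mul_comm]

theorem map_eq_map_finRange {α β : Type*} (l : List α) (g : α → β) :
    l.map g = (List.finRange l.length).map fun k => g (l.get k) := by
  conv_lhs => rw [← List.map_get_finRange l, List.map_map]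
  rfl

theorem sum_bucket (h : Fin n → Fin B) (b : Fin B) (g : Fin n → ℝ) :
    ∑ k, g (((hashRows h).val b).get k) = ∑ j with h j = b, g j := by
  have hnd : ((hashRows h).val b).Nodup := by
    rw [hashRows_val]
    exact (List.nodup_reverse.2 (List.nodup_finRange n)).filter _
  have hfs : ((hashRows h).val b).toFinset = Finset.univ.filter fun j => h j = b := by
    ext j
    simp [hashRows_val]
  rw [← hfs, List.sum_toFinset _ hnd, Fin.sum_univ_def,
    map_eq_map_finRange ((hashRows h).val b)]

theorem length_hashRows_le (h : Fin n → Fin B) (b : Fin B) :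
    ((hashRows h).val b).length ≤ n := by
  rw [hashRows_val]
  exact (List.length_filter_le _ _).trans (by simp)

theorem exists_get_hashRows (h : Fin n → Fin B) (i : Fin n) :
    ∃ k, ((hashRows h).val (h i)).get k = i := by
  have : i ∈ (hashRows h).val (h i) := by simp [hashRows_val]
  exact List.mem_iff_get.1 this

/-! ### Growth of the bounds during the algorithm -/

variable {p c θ κ v : ℝ} {L : LewisRoutine d} {A : Matrix (Fin n) (Fin d) ℝ}

theorem le_update_max (s : Fin n → ℝ) (i : Fin n) :
    s ≤ Function.update s i (max v (s i)) := by
  intro j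
  by_cases h : j = i
  · subst h
    simp
  · simp [h]

theorem processBucket_val (s : Fin n → ℝ) (S : List (Fin n)) :
    (processBucket p θ L A v s S).val = (List.finRange S.length).foldl (fun s k =>
      if θ ≤ (d : ℝ) ^ max 0 (p / 2 - 1) * (L S.length (A.submatrix S.get id)).val k then
        Function.update s (S.get k) (max v (s (S.get k))) else s) s := by
  change ((List.finRange S.length).foldlM (m := Timed) _ _).val = _
  rw [foldlM_val]
  congr 1
  funext s k
  change (ite _ _ _ : Timed (Fin n → ℝ)).val = _
  rw [apply_ite Timed.val]
  rfl

theorem le_processStep (S : List (Fin n)) (w : Fin S.length → ℝ) (s : Fin n → ℝ)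
    (k : Fin S.length) :
    s ≤ if θ ≤ (d : ℝ) ^ max 0 (p / 2 - 1) * w k then
        Function.update s (S.get k) (max v (s (S.get k))) else s := by
  split_ifs
  · exact le_update_max _ _
  · exact le_rfl

theorem le_processBucket (s : Fin n → ℝ) (S : List (Fin n)) :
    s ≤ (processBucket p θ L A v s S).val := by
  rw [processBucket_val]
  exact le_foldl (fun s k => le_processStep S _ s k) _ _

theorem hashRound_val (r : ℕ) (h : Fin n → Fin (10 * 2 ^ r)) (s : Fin n → ℝ) :
    (hashRound p θ L A r h s).val = (List.finRange (10 * 2 ^ r)).foldl (fun s b =>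
      (processBucket p θ L A (2 / 2 ^ r) s ((hashRows h).val b)).val) s := by
  change ((List.finRange (10 * 2 ^ r)).foldlM (m := Timed) _ _).val = _
  rw [foldlM_val]
  rfl

theorem le_hashRound (r : ℕ) (h : Fin n → Fin (10 * 2 ^ r)) (s : Fin n → ℝ) :
    s ≤ (hashRound p θ L A r h s).val := by
  rw [hashRound_val]
  exact le_foldl (fun s b => le_processBucket s _) _ _

/-- A round raises the bound of row `i` if the approximate Lewis weight of `i` in its bucket reaches
the threshold. -/
theorem le_hashRound_apply (r : ℕ) (h : Fin n → Fin (10 * 2 ^ r)) (s : Fin n → ℝ)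
    (b : Fin (10 * 2 ^ r))
    (k : Fin ((hashRows h).val b).length)
    (hk : θ ≤ (d : ℝ) ^ max 0 (p / 2 - 1) *
      (L _ (A.submatrix ((hashRows h).val b).get id)).val k) :
    2 / 2 ^ r ≤ (hashRound p θ L A r h s).val (((hashRows h).val b).get k) := by
  rw [hashRound_val]
  refine le_foldl_apply (fun s b => le_processBucket s _) (List.mem_finRange b) (fun s => ?_) s
  rw [processBucket_val]
  refine le_foldl_apply (fun s k => le_processStep _ _ s k) (List.mem_finRange k) (fun s => ?_) s
  rw [if_pos hk]
  simp

theorem sensitivityBounds_val {τ : ℝ} (ω : HashSeed c n τ) :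
    (sensitivityBounds p c θ L A τ ω).val =
      (List.finRange (levels n τ)).foldl (fun s (r : Fin (levels n τ)) =>
      (List.finRange (rounds c n)).foldl (fun s (t : Fin (rounds c n)) =>
        (hashRound p θ L A ((r : ℕ) + 1) (ω r t) s).val) s) (fun _ => 2 * τ / n) := by
  change ((List.finRange (levels n τ)).foldlM (m := Timed) _ _).val = _
  rw [foldlM_val]
  congr 1
  funext s r
  change ((List.finRange (rounds c n)).foldlM (m := Timed) _ _).val = _
  rw [foldlM_val]
  rfl

theorem initial_le_sensitivityBounds {τ : ℝ} (ω : HashSeed c n τ) (i : Fin n) :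
    2 * τ / n ≤ (sensitivityBounds p c θ L A τ ω).val i := by
  rw [sensitivityBounds_val]
  exact le_foldl (fun s r => le_foldl (fun s t => le_hashRound _ _ s) _ _) _
    (fun _ => 2 * τ / n) i

theorem le_sensitivityBounds_apply {τ : ℝ} (ω : HashSeed c n τ) (r : Fin (levels n τ))
    (t : Fin (rounds c n)) {v : ℝ} {i : Fin n}
    (hv : ∀ s, v ≤ (hashRound p θ L A ((r : ℕ) + 1) (ω r t) s).val i) :
    v ≤ (sensitivityBounds p c θ L A τ ω).val i := by
  rw [sensitivityBounds_val]
  refine le_foldl_apply (fun s r => le_foldl (fun s t => le_hashRound _ _ s) _ _)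
    (List.mem_finRange r) (fun s => ?_) _
  exact le_foldl_apply (fun s t => le_hashRound _ _ s) (List.mem_finRange t) hv s

/-! ### The sum of the bounds -/

theorem LewisRoutine.Approximates.nonneg (hp : 0 < p) (hκ : 0 < κ) (hL : L.Approximates p κ n)
    {m : ℕ} (hm : m ≤ n) (B : Matrix (Fin m) (Fin d) ℝ) (i : Fin m) : 0 ≤ (L m B).val i :=
  nonneg_of_mul_nonneg_right ((lewisWeight_nonneg hp B i).trans ((hL m hm B).1 i)) hκ

/-- The bounds of at most `d ^ max 0 (p / 2 - 1) * (κ * d) / θ` rows of a bucket are raised. -/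
theorem sum_processBucket_le (hp : 0 < p) (hκ : 0 < κ) (hθ : 0 < θ) (hv : 0 ≤ v)
    (hL : L.Approximates p κ n) {s : Fin n → ℝ} (hs : 0 ≤ s) {S : List (Fin n)}
    (hS : S.length ≤ n) :
    ∑ i, (processBucket p θ L A v s S).val i ≤
      ∑ i, s i + v * ((d : ℝ) ^ max 0 (p / 2 - 1) * (κ * d) / θ) := by
  rw [processBucket_val]
  set w := (L S.length (A.submatrix S.get id)).val with hw
  have hw0 : ∀ k, 0 ≤ w k := hL.nonneg hp hκ hS _
  have hD : (0 : ℝ) ≤ (d : ℝ) ^ max 0 (p / 2 - 1) := by positivity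
  refine (sum_foldl_finRange_le (le_processStep S w)
    (g := fun k => v * ((d : ℝ) ^ max 0 (p / 2 - 1) * w k / θ)) ?_ hs).trans ?_
  · intro s hs k
    split_ifs with h
    -- A raised row has `1 ≤ d ^ max 0 (p / 2 - 1) * w k / θ`, which pays for the increase by `v`.
    · have h1 : v ≤ v * ((d : ℝ) ^ max 0 (p / 2 - 1) * w k / θ) :=
        le_mul_of_one_le_right hv ((one_le_div hθ).2 h)
      have h2 : max v (s (S.get k)) ≤ s (S.get k) + v :=
        max_le (le_add_of_nonneg_left (hs _)) (le_add_of_nonneg_right hv)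
      rw [Finset.sum_update_of_mem (Finset.mem_univ _),
        ← Finset.add_sum_erase _ s (Finset.mem_univ (S.get k)), Finset.sdiff_singleton_eq_erase]
      linarith
    · exact le_add_of_nonneg_right (mul_nonneg hv (div_nonneg (mul_nonneg hD (hw0 k)) hθ.le))
  · rw [← Finset.mul_sum, ← Finset.sum_div, ← Finset.mul_sum]
    gcongr
    exact (hL _ hS _).2

theorem sum_hashRound_le (hp : 0 < p) (hκ : 0 < κ) (hθ : 0 < θ)
    (hL : L.Approximates p κ n) {s : Fin n → ℝ} (hs : 0 ≤ s) (r : ℕ)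
    (h : Fin n → Fin (10 * 2 ^ r)) :
    ∑ i, (hashRound p θ L A r h s).val i ≤
      ∑ i, s i + 20 * ((d : ℝ) ^ max 0 (p / 2 - 1) * (κ * d) / θ) := by
  rw [hashRound_val]
  refine (sum_foldl_finRange_le (fun s b => le_processBucket s _)
    (fun s hs b => sum_processBucket_le hp hκ hθ (by positivity) hL hs
      (length_hashRows_le h b)) hs).trans (le_of_eq ?_)
  rw [Finset.sum_const, Finset.card_univ, Fintype.card_fin, nsmul_eq_mul]
  push_cast
  field_simp
  ring

theorem sum_sensitivityBounds_le {τ : ℝ} (hp : 0 < p) (hκ : 0 < κ) (hθ : 0 < θ) (hτ : 0 ≤ τ)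
    (hn : 0 < n) (hL : L.Approximates p κ n) (ω : HashSeed c n τ) :
    ∑ i, (sensitivityBounds p c θ L A τ ω).val i ≤ 2 * τ +
      levels n τ * (rounds c n * (20 * ((d : ℝ) ^ max 0 (p / 2 - 1) * (κ * d) / θ))) := by
  rw [sensitivityBounds_val]
  refine (sum_foldl_finRange_le
    (fun s r => le_foldl (fun s t => le_hashRound _ _ s) _ _)
    (fun s hs r => sum_foldl_finRange_le (fun s t => le_hashRound _ _ s)
      (fun s hs t => sum_hashRound_le hp hκ hθ hL hs _ _) hs)
    (s := fun _ => 2 * τ / n) (fun _ => by positivity)).trans (le_of_eq ?_)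
  have : (n : ℝ) ≠ 0 := by positivity
  simp only [Finset.sum_const, Finset.card_univ, Fintype.card_fin, nsmul_eq_mul]
  field_simp

/-! ### Running time -/

theorem processBucket_time_le {c₀ T : ℝ} (hL : L.RunsIn c₀ T n) (s : Fin n → ℝ)
    {S : List (Fin n)} (hS : S.length ≤ n) :
    ((processBucket p θ L A v s S).time : ℝ) ≤
      1 + c₀ * T + ∑ k, (7 + (1 + c₀ * Real.log n) * rowNnz A (S.get k)) := by
  have hloop : ∀ w : Fin S.length → ℝ, (((List.finRange S.length).foldlM (fun s k => (do
      spend 3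
      if θ ≤ (d : ℝ) ^ max 0 (p / 2 - 1) * w k then raise v s (S.get k) else pure s :
        Timed (Fin n → ℝ))) s).time : ℝ) ≤ ∑ k : Fin S.length, 6 := by
    intro w
    refine foldlM_finRange_time_le _ _ (fun s k => ?_) s
    change ((3 + (ite _ _ _ : Timed (Fin n → ℝ)).time : ℕ) : ℝ) ≤ 6
    split_ifs
    · change ((3 + 3 : ℕ) : ℝ) ≤ 6
      norm_num
    · change ((3 + 0 : ℕ) : ℝ) ≤ 6
      norm_num
  have hgather : ((gather A S).time : ℝ) = 1 + ∑ k, (1 + (rowNnz A (S.get k) : ℝ)) := by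
    change ((1 + (S.map fun i => 1 + rowNnz A i).sum : ℕ) : ℝ) = _
    rw [map_eq_map_finRange, ← Fin.sum_univ_def]
    push_cast
    rfl
  have hroutine : ((L S.length (A.submatrix S.get id)).time : ℝ) ≤
      c₀ * ((∑ k, (rowNnz A (S.get k) : ℝ)) * Real.log n + T) := by
    have := hL _ hS (A.submatrix S.get id)
    rwa [nnz, Nat.cast_sum] at this
  have heq : (processBucket p θ L A v s S).time = (gather A S).time +
      ((L S.length (A.submatrix S.get id)).time + ((List.finRange S.length).foldlM (fun s k => (do
      spend 3
      if θ ≤ (d : ℝ) ^ max 0 (p / 2 - 1) * (L S.length (A.submatrix S.get id)).val k then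
        raise v s (S.get k) else pure s : Timed (Fin n → ℝ))) s).time) := rfl
  rw [heq, Nat.cast_add, Nat.cast_add, hgather]
  refine (add_le_add_right (add_le_add hroutine (hloop _)) _).trans (le_of_eq ?_)
  simp only [Finset.sum_add_distrib, ← Finset.mul_sum, Finset.sum_const, nsmul_eq_mul]
  ring

theorem hashRound_time_le {c₀ T : ℝ} (hL : L.RunsIn c₀ T n) (r : ℕ)
    (h : Fin n → Fin (10 * 2 ^ r)) (s : Fin n → ℝ) :
    ((hashRound p θ L A r h s).time : ℝ) ≤
      10 * 2 ^ r * (3 + c₀ * T) + 9 * n + (1 + c₀ * Real.log n) * nnz A := by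
  have heq : (hashRound p θ L A r h s).time = (hashRows h).time +
      ((List.finRange (10 * 2 ^ r)).foldlM (fun s b => (do
        spend 1
        processBucket p θ L A (2 / 2 ^ r) s ((hashRows h).val b) : Timed (Fin n → ℝ))) s).time :=
    rfl
  have hloop := foldlM_finRange_time_le (fun s b => (do
        spend 1
        processBucket p θ L A (2 / 2 ^ r) s ((hashRows h).val b) : Timed (Fin n → ℝ)))
    (fun b => 1 + (1 + c₀ * T +
      ∑ j with h j = b, (7 + (1 + c₀ * Real.log n) * (rowNnz A j : ℝ)))) (fun s b => by
        have := processBucket_time_le (p := p) (θ := θ) (A := A) (v := 2 / 2 ^ r) hL s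
          (length_hashRows_le h b)
        rw [sum_bucket h b fun j => 7 + (1 + c₀ * Real.log n) * (rowNnz A j : ℝ)] at this
        refine (le_of_eq (Nat.cast_add _ _)).trans (add_le_add ?_ this)
        exact (Nat.cast_one (R := ℝ)).le) s
  rw [heq, Nat.cast_add]
  refine (add_le_add (hashRows_time_le h) hloop).trans (le_of_eq ?_)
  have hfib : ∑ b, ∑ j with h j = b, (7 + (1 + c₀ * Real.log n) * (rowNnz A j : ℝ)) =
      7 * n + (1 + c₀ * Real.log n) * nnz A := by
    rw [Finset.sum_fiberwise, Finset.sum_add_distrib, ← Finset.mul_sum, nnz, Nat.cast_sum]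
    simp [mul_comm]
  rw [Finset.sum_add_distrib, Finset.sum_add_distrib, hfib]
  simp only [Finset.sum_const, Finset.card_univ, Fintype.card_fin, nsmul_eq_mul]
  push_cast
  ring

theorem sensitivityBounds_time_le {c₀ T τ : ℝ} (hL : L.RunsIn c₀ T n) (ω : HashSeed c n τ) :
    ((sensitivityBounds p c θ L A τ ω).time : ℝ) ≤ 10 + n + 3 * levels n τ +
      rounds c n * (levels n τ * (1 + 9 * n + (1 + c₀ * Real.log n) * nnz A) +
        20 * (2 ^ levels n τ - 1) * (3 + c₀ * T)) := by
  have hloop := foldlM_finRange_time_le (fun s (r : Fin (levels n τ)) => (do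
      spend 3
      (List.finRange (rounds c n)).foldlM (fun s (t : Fin (rounds c n)) => do
        spend 1
        hashRound p θ L A ((r : ℕ) + 1) (ω r t) s) s : Timed (Fin n → ℝ)))
    (fun r => 3 + ∑ _t : Fin (rounds c n), (1 + (10 * 2 ^ ((r : ℕ) + 1) * (3 + c₀ * T) + 9 * n +
      (1 + c₀ * Real.log n) * nnz A))) (fun s r => by
        refine (le_of_eq (Nat.cast_add _ _)).trans (add_le_add ?_
          (foldlM_finRange_time_le _ _ (fun s t => ?_) s))
        · exact (Nat.cast_ofNat (R := ℝ)).le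
        · refine (le_of_eq (Nat.cast_add _ _)).trans (add_le_add ?_ (hashRound_time_le hL _ _ s))
          exact (Nat.cast_one (R := ℝ)).le) (fun _ => 2 * τ / n)
  have heq : (sensitivityBounds p c θ L A τ ω).time = 10 + (n +
      ((List.finRange (levels n τ)).foldlM (fun s (r : Fin (levels n τ)) => (do
      spend 3
      (List.finRange (rounds c n)).foldlM (fun s (t : Fin (rounds c n)) => do
        spend 1
        hashRound p θ L A ((r : ℕ) + 1) (ω r t) s) s : Timed (Fin n → ℝ)))
        (fun _ => 2 * τ / n)).time) := rfl
  rw [heq, Nat.cast_add, Nat.cast_add]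
  -- The levels are `1, …, levels n τ`, hence the exponents `r + 1`.
  have hgeom : ∑ r : Fin (levels n τ), (2 : ℝ) ^ ((r : ℕ) + 1) = 2 * (2 ^ levels n τ - 1) := by
    rw [Fin.sum_univ_eq_sum_range (fun r => (2 : ℝ) ^ (r + 1))]
    simp only [pow_succ]
    rw [← Finset.sum_mul, geom_sum_eq (by norm_num)]
    ring
  have hsum : ∑ r : Fin (levels n τ), (3 + ∑ _t : Fin (rounds c n),
      (1 + (10 * (2 : ℝ) ^ ((r : ℕ) + 1) * (3 + c₀ * T) + 9 * n +
        (1 + c₀ * Real.log n) * nnz A))) = 3 * levels n τ +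
      rounds c n * (levels n τ * (1 + 9 * n + (1 + c₀ * Real.log n) * nnz A) +
        20 * (2 ^ levels n τ - 1) * (3 + c₀ * T)) := by
    simp only [Finset.sum_const, Finset.card_univ, Fintype.card_fin, nsmul_eq_mul,
      Finset.sum_add_distrib, ← Finset.mul_sum, ← Finset.sum_mul, hgeom]
    ring
  rw [hsum] at hloop
  push_cast
  linarith

end Buckets

/-! ### Numbers of levels and rounds -/

theorem half_le_log {n : ℕ} (hn : 2 ≤ n) : 1 / 2 ≤ Real.log n := by
  have h1 : Real.log 2 ≤ Real.log n := Real.log_le_log two_pos (by exact_mod_cast hn)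
  linarith [Real.log_two_gt_d9]

theorem levels_lt {n : ℕ} {τ : ℝ} (h1 : 1 ≤ τ) (h2 : τ ≤ n) :
    (levels n τ : ℝ) < Real.logb 2 (n / τ) + 1 := by
  refine Nat.ceil_lt_add_one (Real.logb_nonneg one_lt_two ?_)
  rwa [one_le_div (by linarith)]

theorem two_pow_levels_le {n : ℕ} {τ : ℝ} (h1 : 1 ≤ τ) (h2 : τ ≤ n) :
    (2 : ℝ) ^ levels n τ ≤ 2 * (n / τ) := by
  have hpos : 0 < n / τ := by
    have : (0 : ℝ) < n := by linarith
    positivity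
  rw [← Real.rpow_natCast]
  calc (2 : ℝ) ^ (levels n τ : ℝ) ≤ 2 ^ (Real.logb 2 (n / τ) + 1) :=
        Real.rpow_le_rpow_of_exponent_le one_le_two (levels_lt h1 h2).le
    _ = 2 * (n / τ) := by
      rw [Real.rpow_add_one two_ne_zero, Real.rpow_logb two_pos (by norm_num) hpos, mul_comm]

theorem le_two_pow_levels {n : ℕ} {τ : ℝ} (h1 : 1 ≤ τ) (h2 : τ ≤ n) :
    n / τ ≤ (2 : ℝ) ^ levels n τ := by
  have hpos : 0 < n / τ := by
    have : (0 : ℝ) < n := by linarith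
    positivity
  rw [← Real.rpow_natCast, ← Real.logb_le_iff_le_rpow one_lt_two hpos]
  exact Nat.le_ceil _

theorem levels_le {n : ℕ} {τ : ℝ} (hn : 2 ≤ n) (h1 : 1 ≤ τ) (h2 : τ ≤ n) :
    (levels n τ : ℝ) ≤ 4 * Real.log n := by
  have hl := half_le_log hn
  have hn0 : (0 : ℝ) < n := by linarith
  have h3 : Real.logb 2 (n / τ) ≤ 2 * Real.log n := by
    rw [Real.logb, div_le_iff₀ (Real.log_pos one_lt_two)]
    have h4 : Real.log (n / τ) ≤ Real.log n :=
      Real.log_le_log (by positivity) (div_le_self hn0.le h1)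
    nlinarith [Real.log_two_gt_d9]
  linarith [levels_lt h1 h2]

theorem rounds_le {n : ℕ} {c : ℝ} (hc : 0 ≤ c) (hn : 2 ≤ n) :
    (rounds c n : ℝ) ≤ (c + 2) * Real.log n := by
  have hl := half_le_log hn
  have := Nat.ceil_lt_add_one (a := c * Real.log n) (by positivity)
  rw [rounds]
  linarith

theorem levels_one {τ : ℝ} (h1 : 1 ≤ τ) (h2 : τ ≤ (1 : ℕ)) : levels 1 τ = 0 := by
  have : τ = 1 := le_antisymm (by simpa using h2) h1
  simp [levels, this]

theorem exists_sum_sensitivityBounds_le {p c θ κ : ℝ} (hp : 0 < p) (hc : 0 < c) (hθ : 0 < θ)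
    (hκ : 0 < κ) : ∃ C : ℝ, 0 < C ∧
      ∀ (n d : ℕ) (A : Matrix (Fin n) (Fin d) ℝ) (τ : ℝ), 1 ≤ τ → τ ≤ n →
        ∀ L : LewisRoutine d, L.Approximates p κ n → ∀ ω : HashSeed c n τ,
          ∑ i, (sensitivityBounds p c θ L A τ ω).val i ≤
            C * ((d : ℝ) ^ max 1 (p / 2) * Real.log n ^ 2 + τ) := by
  refine ⟨2 + 80 * (c + 2) * κ / θ, by positivity, fun n d A τ h1 h2 L hL ω => ?_⟩
  have hn : 0 < n := by
    have : (0 : ℝ) < n := by linarith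
    exact_mod_cast this
  have h := sum_sensitivityBounds_le (A := A) hp hκ hθ (by linarith) hn hL ω
  have hd : (d : ℝ) ^ max 0 (p / 2 - 1) * d = (d : ℝ) ^ max 1 (p / 2) := by
    rcases Nat.eq_zero_or_pos d with rfl | hd
    · rw [Nat.cast_zero, mul_zero, Real.zero_rpow (by positivity)]
    · rw [← Real.rpow_add_one (by positivity), ← max_add_add_right, zero_add, sub_add_cancel]
  set E := (d : ℝ) ^ max 1 (p / 2) with hE
  have hE0 : 0 ≤ E := by positivity
  rw [show (d : ℝ) ^ max 0 (p / 2 - 1) * (κ * d) / θ = κ / θ * E by rw [← hd]; ring] at h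
  refine h.trans ?_
  have hτ : 0 ≤ 80 * (c + 2) * κ / θ * τ := by positivity
  rcases Nat.lt_or_ge n 2 with hlt | hn2
  · obtain rfl : n = 1 := by omega
    rw [levels_one h1 h2]
    simp
    nlinarith
  · have hl := half_le_log hn2
    have h3 : (levels n τ : ℝ) * rounds c n ≤ 4 * Real.log n * ((c + 2) * Real.log n) :=
      mul_le_mul (levels_le hn2 h1 h2) (rounds_le hc.le hn2) (by positivity) (by positivity)
    have h4 := mul_le_mul_of_nonneg_right h3 (show 0 ≤ 20 * (κ / θ * E) by positivity)
    have h5 : 0 ≤ 2 * (E * Real.log n ^ 2) := by positivity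
    calc 2 * τ + levels n τ * (rounds c n * (20 * (κ / θ * E)))
        ≤ 2 * τ + 4 * Real.log n * ((c + 2) * Real.log n) * (20 * (κ / θ * E)) := by linarith
      _ ≤ 2 * τ + 4 * Real.log n * ((c + 2) * Real.log n) * (20 * (κ / θ * E)) +
          (2 * (E * Real.log n ^ 2) + 80 * (c + 2) * κ / θ * τ) := by linarith
      _ = _ := by ring

theorem exists_sensitivityBounds_time_le (p : ℝ) {c : ℝ} (θ : ℝ) (hc : 0 < c) {c₀ : ℝ}
    (hc₀ : 0 < c₀) : ∃ C : ℝ, 0 < C ∧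
        ∀ (n d : ℕ) (A : Matrix (Fin n) (Fin d) ℝ) (τ : ℝ), 2 ≤ n → n ≤ nnz A → 1 ≤ τ → τ ≤ n →
        ∀ (L : LewisRoutine d) (T : ℝ), 0 ≤ T → L.RunsIn c₀ T n →
        ∀ ω : HashSeed c n τ,
          ((sensitivityBounds p c θ L A τ ω).time : ℝ) ≤
            C * ((nnz A : ℝ) * Real.log n ^ 3 + (n : ℝ) * T / τ * Real.log n) := by
  refine ⟨72 + 4 * (c + 2) * (22 + c₀) + 480 * (c + 2) + 40 * (c + 2) * c₀, by positivity,
    fun n d A τ hn hN h1 h2 L T hT hL ω => ?_⟩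
  have h := sensitivityBounds_time_le (p := p) (θ := θ) (A := A) hL ω
  refine h.trans ?_
  have hl := half_le_log hn
  have hlev := levels_le hn h1 h2
  have hrnd := rounds_le hc.le hn
  have hpow := two_pow_levels_le h1 h2
  have hnN : (n : ℝ) ≤ nnz A := by exact_mod_cast hN
  have hn2 : (2 : ℝ) ≤ n := by exact_mod_cast hn
  have hnτ : n / τ ≤ nnz A := (div_le_self (by linarith) h1).trans hnN
  have hnτ0 : 0 ≤ n / τ := by positivity
  rw [show (n : ℝ) * T / τ = n / τ * T by ring]
  set ℓ := Real.log n
  set N : ℝ := (nnz A : ℝ)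
  set q : ℝ := n / τ
  have hN2 : 2 ≤ N := by linarith
  have hℓ2 : 1 ≤ 4 * ℓ ^ 2 := by nlinarith
  have hℓ3 : 1 ≤ 8 * ℓ ^ 3 := by nlinarith
  have hN3 : N ≤ 8 * (N * ℓ ^ 3) := by nlinarith
  have hNℓ : N * ℓ ≤ 4 * (N * ℓ ^ 3) := by
    have : 0 ≤ N * ℓ := by positivity
    nlinarith
  have hNℓ2 : N * ℓ ^ 2 ≤ 2 * (N * ℓ ^ 3) := by
    have : 0 ≤ N * ℓ ^ 2 := by positivity
    nlinarith
  have hlow : 10 + (n : ℝ) + 3 * levels n τ ≤ 72 * (N * ℓ ^ 3) := by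
    nlinarith
  have hmid : (rounds c n : ℝ) * (levels n τ * (1 + 9 * n + (1 + c₀ * ℓ) * N)) ≤
      4 * (c + 2) * (22 + c₀) * (N * ℓ ^ 3) := by
    have h3 : 1 + 9 * (n : ℝ) + (1 + c₀ * ℓ) * N ≤ 11 * N + c₀ * ℓ * N := by linarith
    calc (rounds c n : ℝ) * (levels n τ * (1 + 9 * n + (1 + c₀ * ℓ) * N))
        ≤ ((c + 2) * ℓ) * ((4 * ℓ) * (11 * N + c₀ * ℓ * N)) := by gcongr
      _ = 4 * (c + 2) * (11 * (N * ℓ ^ 2) + c₀ * (N * ℓ ^ 3)) := by ring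
      _ ≤ 4 * (c + 2) * (11 * (2 * (N * ℓ ^ 3)) + c₀ * (N * ℓ ^ 3)) := by gcongr
      _ = _ := by ring
  have hhigh : (rounds c n : ℝ) * (20 * (2 ^ levels n τ - 1) * (3 + c₀ * T)) ≤
      480 * (c + 2) * (N * ℓ ^ 3) + 40 * (c + 2) * c₀ * (q * T * ℓ) := by
    have h3 : (2 : ℝ) ^ levels n τ - 1 ≤ 2 * q := by linarith
    have h4 : (0 : ℝ) ≤ 2 ^ levels n τ - 1 := sub_nonneg.2 (one_le_pow₀ one_le_two)
    calc (rounds c n : ℝ) * (20 * (2 ^ levels n τ - 1) * (3 + c₀ * T))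
        ≤ ((c + 2) * ℓ) * (20 * (2 * q) * (3 + c₀ * T)) := by gcongr
      _ = 120 * (c + 2) * (q * ℓ) + 40 * (c + 2) * c₀ * (q * T * ℓ) := by ring
      _ ≤ 120 * (c + 2) * (N * ℓ) + 40 * (c + 2) * c₀ * (q * T * ℓ) := by gcongr
      _ ≤ 120 * (c + 2) * (4 * (N * ℓ ^ 3)) + 40 * (c + 2) * c₀ * (q * T * ℓ) := by gcongr
      _ = _ := by ring
  have hX : 0 ≤ N * ℓ ^ 3 := by positivity
  have hY : 0 ≤ q * T * ℓ := by positivity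
  have hc1 : 0 ≤ 40 * (c + 2) * c₀ * (N * ℓ ^ 3) := by positivity
  have hc2 : 0 ≤ (72 + 4 * (c + 2) * (22 + c₀) + 480 * (c + 2)) * (q * T * ℓ) := by positivity
  linarith

/-! ### `M`-sensitivities -/

section Sensitivity

variable {M : ℝ≥0 → ℝ≥0} {p cU : ℝ} {n d : ℕ} {A : Matrix (Fin n) (Fin d) ℝ} {i : Fin n}

theorem mNorm_rpow (hp : 0 < p) (y : Fin n → ℝ) :
    mNorm M p y ^ p = ∑ j, (M (Real.nnabs (y j)) : ℝ) := by
  rw [mNorm, ← Real.rpow_mul (by positivity), one_div_mul_cancel hp.ne', Real.rpow_one]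

theorem mSensitivity_le_one (hp : 0 < p) : mSensitivity M p A i ≤ 1 := by
  refine Real.sSup_le ?_ zero_le_one
  rintro t ⟨x, -, rfl⟩
  rw [mNorm_rpow hp]
  refine div_le_one_of_le₀ ?_ (by positivity)
  exact Finset.single_le_sum (f := fun j => (M (Real.nnabs (A.mulVec x j)) : ℝ))
    (fun j _ => by positivity) (Finset.mem_univ i)

theorem exists_of_lt_mSensitivity (hp : 0 < p) {v : ℝ} (hv : 0 < v)
    (h : v < mSensitivity M p A i) :
    ∃ x, v * ∑ j, (M (Real.nnabs (A.mulVec x j)) : ℝ) < M (Real.nnabs (A.mulVec x i)) := by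
  have hne : {t : ℝ | ∃ x : Fin d → ℝ, A.mulVec x ≠ 0 ∧
      t = (M (Real.nnabs (A.mulVec x i)) : ℝ) / mNorm M p (A.mulVec x) ^ p}.Nonempty := by
    by_contra hemp
    rw [Set.not_nonempty_iff_eq_empty] at hemp
    rw [mSensitivity, hemp, Real.sSup_empty] at h
    linarith
  obtain ⟨t, ⟨x, -, rfl⟩, hx⟩ := exists_lt_of_lt_csSup hne h
  refine ⟨x, ?_⟩
  rw [mNorm_rpow hp] at hx
  have h0 : 0 ≤ ∑ j, (M (Real.nnabs (A.mulVec x j)) : ℝ) := by positivity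
  rcases h0.eq_or_lt with h1 | h1
  · rw [← h1, div_zero] at hx
    linarith
  · exact (lt_div_iff₀ h1).1 hx

/-- Polynomial growth compares the `p`-th powers with the values of `M` below a given entry. -/
theorem IsMLoss.rpow_abs_mul_le (hM : IsMLoss M p cU) {a b : ℝ}
    (h : M (Real.nnabs b) < M (Real.nnabs a)) :
    |b| ^ p * M (Real.nnabs a) ≤ cU * |a| ^ p * M (Real.nnabs b) := by
  have hp := hM.degree_pos
  have hcU : 0 ≤ cU := zero_le_one.trans hM.one_le_const
  have hlt : Real.nnabs b < Real.nnabs a := hM.mono.reflect_lt h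
  rcases eq_or_ne b 0 with rfl | hb
  · rw [abs_zero, Real.zero_rpow hp.ne', zero_mul]
    positivity
  · have hb' : 0 < |b| := abs_pos.2 hb
    have hg := hM.growth (Real.nnabs b) (Real.nnabs a) (by
      rw [← NNReal.coe_pos, Real.coe_nnabs]; exact hb') hlt
    rw [Real.coe_nnabs, Real.coe_nnabs, Real.div_rpow (abs_nonneg _) (abs_nonneg _)] at hg
    have hbp : 0 < |b| ^ p := Real.rpow_pos_of_pos hb' _
    calc |b| ^ p * (M (Real.nnabs a) : ℝ)
        ≤ |b| ^ p * (cU * (|a| ^ p / |b| ^ p) * M (Real.nnabs b)) := by gcongr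
      _ = _ := by field_simp

/-- If the other entries of `a` indexed by `s` have less `M`-mass than `a i`, then
`|a i| ^ p` is a constant fraction of the `ℓ_p` mass on `s`. -/
theorem IsMLoss.sum_rpow_abs_le (hM : IsMLoss M p cU) {ι : Type*} [DecidableEq ι] {s : Finset ι}
    {i : ι} (hi : i ∈ s) {a : ι → ℝ}
    (h : ∑ j ∈ s.erase i, (M (Real.nnabs (a j)) : ℝ) < M (Real.nnabs (a i))) :
    ∑ j ∈ s, |a j| ^ p ≤ (1 + cU) * |a i| ^ p := by
  have hcU : 0 ≤ cU := zero_le_one.trans hM.one_le_const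
  have hpos : (0 : ℝ) < M (Real.nnabs (a i)) :=
    lt_of_le_of_lt (Finset.sum_nonneg fun _ _ => NNReal.coe_nonneg _) h
  have hrest : ∑ j ∈ s.erase i, |a j| ^ p ≤ cU * |a i| ^ p := by
    refine le_of_mul_le_mul_right ?_ hpos
    rw [Finset.sum_mul]
    calc ∑ j ∈ s.erase i, |a j| ^ p * M (Real.nnabs (a i))
        ≤ ∑ j ∈ s.erase i, cU * |a i| ^ p * M (Real.nnabs (a j)) := by
          refine Finset.sum_le_sum fun j hj => hM.rpow_abs_mul_le ?_
          rw [← NNReal.coe_lt_coe]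
          exact (Finset.single_le_sum (f := fun j => (M (Real.nnabs (a j)) : ℝ))
            (fun _ _ => NNReal.coe_nonneg _) hj).trans_lt h
      _ = cU * |a i| ^ p * ∑ j ∈ s.erase i, (M (Real.nnabs (a j)) : ℝ) :=
          (Finset.mul_sum _ _ _).symm
      _ ≤ cU * |a i| ^ p * M (Real.nnabs (a i)) := by gcongr
  rw [← Finset.add_sum_erase _ _ hi]
  linarith

end Sensitivity

/-! ### Hash functions that isolate a row -/

section Hashing

variable {n B : ℕ}

theorem card_collision_mul_le {i j : Fin n} (hij : j ≠ i) :
    (Finset.univ.filter fun h : Fin n → Fin B => h j = h i).card * B ≤ B ^ n := by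
  -- A colliding `h` and a new value at `j` are both recovered from the updated function.
  have hinj : Set.InjOn (fun q : (Fin n → Fin B) × Fin B => Function.update q.1 j q.2)
      ((Finset.univ.filter fun h : Fin n → Fin B => h j = h i) ×ˢ (Finset.univ : Finset (Fin B)) :
        Finset ((Fin n → Fin B) × Fin B)) := by
    rintro ⟨h, b⟩ hh ⟨h', b'⟩ hh' heq
    simp only [Finset.coe_product, Set.mem_prod, Finset.mem_coe, Finset.mem_filter,
      Finset.mem_univ, true_and, and_true] at hh hh'
    have hval : ∀ l, Function.update h j b l = Function.update h' j b' l := congrFun heq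
    have hb : b = b' := by simpa using hval j
    have hne : ∀ l, l ≠ j → h l = h' l := fun l hl => by
      simpa [Function.update_of_ne hl] using hval l
    have hj : h j = h' j := by rw [hh, hh', hne i hij.symm]
    have : h = h' := by
      funext l
      by_cases hl : l = j
      · rw [hl, hj]
      · exact hne l hl
    rw [this, hb]
  have := Finset.card_le_card_of_injOn (t := Finset.univ) _ (fun _ _ => Finset.mem_univ _) hinj
  simpa using this

/-- Markov's inequality for the mass `∑ j, y j` that collides with row `i`, in terms of the number
of hash functions. -/
theorem card_heavy_collision_mul_le {y : Fin n → ℝ} (hy : ∀ j, 0 ≤ y j) (i : Fin n) :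
    ((Finset.univ.filter fun h : Fin n → Fin B =>
      y i ≤ ∑ j ∈ (Finset.univ.filter fun j => h j = h i).erase i, y j).card : ℝ) * (B * y i) ≤
      (B : ℝ) ^ n * ∑ j, y j := by
  set X := Finset.univ.filter fun h : Fin n → Fin B =>
      y i ≤ ∑ j ∈ (Finset.univ.filter fun j => h j = h i).erase i, y j with hX
  have hsplit : ∀ h : Fin n → Fin B, ∑ j ∈ (Finset.univ.filter fun j => h j = h i).erase i, y j =
      ∑ j ∈ Finset.univ.erase i, if h j = h i then y j else 0 := by
    intro h
    rw [← Finset.sum_filter, ← Finset.filter_erase]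
  have h1 : (X.card : ℝ) * y i ≤ ∑ j ∈ Finset.univ.erase i,
      ((Finset.univ.filter fun h : Fin n → Fin B => h j = h i).card : ℝ) * y j := by
    calc (X.card : ℝ) * y i = ∑ h ∈ X, y i := by rw [Finset.sum_const, nsmul_eq_mul]
      _ ≤ ∑ h ∈ X, ∑ j ∈ (Finset.univ.filter fun j => h j = h i).erase i, y j :=
          Finset.sum_le_sum fun h hh => (Finset.mem_filter.1 hh).2
      _ ≤ ∑ h : Fin n → Fin B, ∑ j ∈ (Finset.univ.filter fun j => h j = h i).erase i, y j :=
          Finset.sum_le_univ_sum_of_nonneg fun h => Finset.sum_nonneg fun j _ => hy j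
      _ = ∑ j ∈ Finset.univ.erase i, ∑ h : Fin n → Fin B, if h j = h i then y j else 0 := by
          simp only [hsplit]
          exact Finset.sum_comm
      _ = _ := by
          refine Finset.sum_congr rfl fun j _ => ?_
          rw [← Finset.sum_filter, Finset.sum_const, nsmul_eq_mul]
  calc (X.card : ℝ) * (B * y i) = B * (X.card * y i) := by ring
    _ ≤ B * ∑ j ∈ Finset.univ.erase i,
        ((Finset.univ.filter fun h : Fin n → Fin B => h j = h i).card : ℝ) * y j := by gcongr
    _ = ∑ j ∈ Finset.univ.erase i,
        ((Finset.univ.filter fun h : Fin n → Fin B => h j = h i).card : ℝ) * B * y j := by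
        rw [Finset.mul_sum]
        exact Finset.sum_congr rfl fun j _ => by ring
    _ ≤ ∑ j ∈ Finset.univ.erase i, (B : ℝ) ^ n * y j := by
        refine Finset.sum_le_sum fun j hj => mul_le_mul_of_nonneg_right ?_ (hy j)
        exact_mod_cast card_collision_mul_le (Finset.ne_of_mem_erase hj)
    _ ≤ ∑ j, (B : ℝ) ^ n * y j :=
        Finset.sum_le_univ_sum_of_nonneg fun j => mul_nonneg (by positivity) (hy j)
    _ = _ := (Finset.mul_sum _ _ _).symm

variable {d : ℕ} {M : ℝ≥0 → ℝ≥0} {p cU κ : ℝ} {L : LewisRoutine d} {A : Matrix (Fin n) (Fin d) ℝ}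

/-- If the rows that share the bucket of row `i` have less `M`-mass at `x` than row `i`, then the
approximate Lewis weight of row `i` in its bucket reaches the threshold. -/
theorem le_approx_lewisWeight (hM : IsMLoss M p cU) (hκ : 1 ≤ κ) (hL : L.Approximates p κ n)
    (h : Fin n → Fin B) {i : Fin n} {x : Fin d → ℝ}
    (hx : ∑ j ∈ (Finset.univ.filter fun j => h j = h i).erase i,
      (M (Real.nnabs (A.mulVec x j)) : ℝ) < M (Real.nnabs (A.mulVec x i)))
    {k : Fin ((hashRows h).val (h i)).length} (hk : ((hashRows h).val (h i)).get k = i) :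
    1 / (κ * (1 + cU)) ≤ (d : ℝ) ^ max 0 (p / 2 - 1) *
      (L _ (A.submatrix ((hashRows h).val (h i)).get id)).val k := by
  have hp := hM.degree_pos
  have hcU := hM.one_le_const
  let S := (hashRows h).val (h i)
  have h1 : |A.mulVec x (S.get k)| ^ p ≤ (d : ℝ) ^ max 0 (p / 2 - 1) *
      lewisWeight p (A.submatrix S.get id) k * ∑ k, |A.mulVec x (S.get k)| ^ p :=
    abs_mulVec_rpow_le_lewisWeight hp (A.submatrix S.get id) x k
  have h2 := (hL _ (length_hashRows_le h (h i)) (A.submatrix S.get id)).1 k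
  have hw := lewisWeight_nonneg hp (A.submatrix S.get id) k
  rw [sum_bucket h (h i) fun j => |A.mulVec x j| ^ p, show S.get k = i from hk] at h1
  have h3 := hM.sum_rpow_abs_le (s := Finset.univ.filter fun j => h j = h i) (i := i)
    (by simp) hx
  have hpos : 0 < |A.mulVec x i| ^ p := by
    refine Real.rpow_pos_of_pos (abs_pos.2 fun h0 => ?_) _
    rw [h0, map_zero, hM.map_zero, NNReal.coe_zero] at hx
    exact absurd hx (not_lt.2 (Finset.sum_nonneg fun _ _ => NNReal.coe_nonneg _))
  set w := lewisWeight p (A.submatrix S.get id) k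
  set w' := (L S.length (A.submatrix S.get id)).val k
  have hD : (0 : ℝ) ≤ (d : ℝ) ^ max 0 (p / 2 - 1) := by positivity
  set D := (d : ℝ) ^ max 0 (p / 2 - 1)
  have hw' : 0 ≤ D * (κ * w') := mul_nonneg hD (hw.trans h2)
  have h4 : 1 * |A.mulVec x i| ^ p ≤ D * (κ * w') * (1 + cU) * |A.mulVec x i| ^ p := by
    calc 1 * |A.mulVec x i| ^ p ≤ D * w * ∑ j with h j = h i, |A.mulVec x j| ^ p := by
          rwa [one_mul]
      _ ≤ D * (κ * w') * ((1 + cU) * |A.mulVec x i| ^ p) := by gcongr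
      _ = _ := by ring
  have h5 := le_of_mul_le_mul_right h4 hpos
  rw [div_le_iff₀ (by positivity)]
  linarith

/-- The level that is responsible for row `i`: at most half of the hash functions at this level fail
to raise the bound of row `i` to its sensitivity. -/
theorem exists_level {c τ : ℝ} (hM : IsMLoss M p cU) (hκ : 1 ≤ κ) (hL : L.Approximates p κ n)
    (h1 : 1 ≤ τ) (h2 : τ ≤ n) {i : Fin n} (hi : 2 * τ / n < mSensitivity M p A i) :
    ∃ (r : Fin (levels n τ)) (X : Finset (Fin n → Fin (10 * 2 ^ ((r : ℕ) + 1)))),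
      2 * X.card ≤ Fintype.card (Fin n → Fin (10 * 2 ^ ((r : ℕ) + 1))) ∧
      ∀ ω : HashSeed c n τ,
        (sensitivityBounds p c (1 / (κ * (1 + cU))) L A τ ω).val i < mSensitivity M p A i →
        ∀ t, ω r t ∈ X := by
  have hp := hM.degree_pos
  have hn : (0 : ℝ) < n := by linarith
  have hτ0 : 0 < τ := by linarith
  have hlev : 1 / (2 : ℝ) ^ levels n τ < mSensitivity M p A i := by
    refine lt_of_le_of_lt ?_ hi
    calc 1 / (2 : ℝ) ^ levels n τ ≤ 1 / (n / τ) := by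
          have := le_two_pow_levels h1 h2
          have : 0 < n / τ := by positivity
          gcongr
      _ = τ / n := by rw [one_div_div]
      _ ≤ 2 * τ / n := by gcongr; linarith
  classical
  -- The first `r` with `1 / 2 ^ r` below the sensitivity is positive and at most `levels n τ`.
  have hex : ∃ r : ℕ, 1 / (2 : ℝ) ^ r < mSensitivity M p A i := ⟨_, hlev⟩
  obtain ⟨r, hr⟩ : ∃ r, Nat.find hex = r + 1 := by
    refine Nat.exists_eq_succ_of_ne_zero fun h => ?_
    have := Nat.find_spec hex
    rw [h, pow_zero, div_one] at this
    exact absurd this (not_lt.2 (mSensitivity_le_one hp))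
  have hspec : 1 / (2 : ℝ) ^ (r + 1) < mSensitivity M p A i := hr ▸ Nat.find_spec hex
  have hmin : mSensitivity M p A i ≤ 2 / 2 ^ (r + 1) := by
    have := not_lt.1 (Nat.find_min hex (m := r) (by omega))
    refine this.trans (le_of_eq ?_)
    rw [pow_succ]
    field_simp
  have hrlev : r < levels n τ := by
    have := Nat.find_min' hex hlev
    omega
  obtain ⟨x, hx⟩ := exists_of_lt_mSensitivity hp (by positivity) hspec
  set y : Fin n → ℝ := fun j => M (Real.nnabs (A.mulVec x j)) with hy
  have hy0 : ∀ j, 0 ≤ y j := fun j => NNReal.coe_nonneg _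
  have hsum0 : 0 ≤ ∑ j, y j := Finset.sum_nonneg fun j _ => hy0 j
  have hyi : 0 < y i := lt_of_le_of_lt (mul_nonneg (by positivity) hsum0) hx
  refine ⟨⟨r, hrlev⟩, Finset.univ.filter fun h =>
    y i ≤ ∑ j ∈ (Finset.univ.filter fun j => h j = h i).erase i, y j, ?_, ?_⟩
  · have hcard := card_heavy_collision_mul_le (B := 10 * 2 ^ (r + 1)) hy0 i
    set X := Finset.univ.filter fun h : Fin n → Fin (10 * 2 ^ (r + 1)) =>
      y i ≤ ∑ j ∈ (Finset.univ.filter fun j => h j = h i).erase i, y j with hX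
    rw [Fintype.card_fun, Fintype.card_fin, Fintype.card_fin]
    have hsum : ∑ j, y j ≤ 2 ^ (r + 1) * y i := by
      rw [one_div, inv_mul_lt_iff₀ (by positivity)] at hx
      exact hx.le
    have hpos : 0 < 2 ^ (r + 1) * y i := by positivity
    have h3 : (10 * X.card : ℝ) * (2 ^ (r + 1) * y i) ≤
        ((10 * 2 ^ (r + 1) : ℕ) : ℝ) ^ n * (2 ^ (r + 1) * y i) := by
      calc (10 * X.card : ℝ) * (2 ^ (r + 1) * y i)
          = X.card * ((10 * 2 ^ (r + 1) : ℕ) * y i) := by push_cast; ring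
        _ ≤ _ := hcard
        _ ≤ _ := by gcongr
    have h4 := le_of_mul_le_mul_right h3 hpos
    have h5 : 10 * X.card ≤ (10 * 2 ^ (r + 1)) ^ n := by exact_mod_cast h4
    change 2 * X.card ≤ (10 * 2 ^ (r + 1)) ^ n
    omega
  · intro ω hω t
    by_contra hnot
    simp only [Finset.mem_filter, Finset.mem_univ, true_and, not_le] at hnot
    refine absurd (hmin.trans ?_) (not_le.2 hω)
    refine le_sensitivityBounds_apply ω ⟨r, hrlev⟩ t fun s => ?_
    obtain ⟨k, hk⟩ := exists_get_hashRows (ω ⟨r, hrlev⟩ t) i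
    have := le_hashRound_apply (p := p) (θ := 1 / (κ * (1 + cU))) (L := L) (A := A) (r + 1)
      (ω ⟨r, hrlev⟩ t) s _ k (le_approx_lewisWeight hM hκ hL _ hnot hk)
    rwa [hk] at this

end Hashing

/-! ### Probabilities -/

/-- Independent repetition: the seeds all of whose `R` coordinates at `r` lie in a set of density at
most `1 / 2` have density at most `1 / 2 ^ R`. -/
theorem card_forall_mem_mul_le {ι : Type*} [Fintype ι] [DecidableEq ι] {R : ℕ} {H : ι → Type*}
    [∀ r, Fintype (H r)] {r : ι} {X : Finset (H r)} (hX : 2 * X.card ≤ Fintype.card (H r))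
    {Y : Finset ((r : ι) → Fin R → H r)} (hY : ∀ ω ∈ Y, ∀ t, ω r t ∈ X) :
    Y.card * 2 ^ R ≤ Fintype.card ((r : ι) → Fin R → H r) := by
  classical
  let F : (r : ι) → Finset (Fin R → H r) :=
    Function.update (fun _ => Finset.univ) r (Fintype.piFinset fun _ => X)
  have hsub : Y ⊆ Fintype.piFinset F := by
    intro ω hω
    rw [Fintype.mem_piFinset]
    intro r'
    by_cases h : r' = r
    · subst h
      simpa [F] using hY ω hω
    · simp [F, h]
  have hcard := Finset.card_le_card hsub
  have hrest : ∏ r' ∈ Finset.univ.erase r, (F r').card =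
      ∏ r' ∈ Finset.univ.erase r, Fintype.card (Fin R → H r') := by
    refine Finset.prod_congr rfl fun r' hr' => ?_
    simp [F, Finset.ne_of_mem_erase hr']
  rw [Fintype.card_piFinset, ← Finset.mul_prod_erase _ _ (Finset.mem_univ r), hrest] at hcard
  rw [Fintype.card_pi, ← Finset.mul_prod_erase _ _ (Finset.mem_univ r)]
  have hF : (F r).card = X.card ^ R := by simp [F]
  rw [hF] at hcard
  calc Y.card * 2 ^ R
      ≤ X.card ^ R * (∏ r' ∈ Finset.univ.erase r, Fintype.card (Fin R → H r')) * 2 ^ R := by gcongr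
    _ = (2 * X.card) ^ R * ∏ r' ∈ Finset.univ.erase r, Fintype.card (Fin R → H r') := by
        rw [mul_pow]; ring
    _ ≤ Fintype.card (H r) ^ R * ∏ r' ∈ Finset.univ.erase r, Fintype.card (Fin R → H r') := by
        gcongr
    _ = _ := by simp

/-- The union bound for a uniform choice from a finite set. -/
theorem uniformOn_real_ge_of_union {Ω : Type*} [Fintype Ω] [Nonempty Ω] [MeasurableSpace Ω]
    [MeasurableSingletonClass Ω] {n : ℕ} {s : Set Ω} (bad : Fin n → Finset Ω)
    (hs : ∀ ω, (∀ i, ω ∉ bad i) → ω ∈ s)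
    (hbad : ∀ i, (bad i).card * (100 * n) ≤ Fintype.card Ω) :
    99 / 100 ≤ (ProbabilityTheory.uniformOn (Set.univ : Set Ω)).real s := by
  have hprob : MeasureTheory.IsProbabilityMeasure
      (ProbabilityTheory.uniformOn (Set.univ : Set Ω)) :=
    ProbabilityTheory.isProbabilityMeasure_uniformOn Set.finite_univ Set.univ_nonempty
  have hΩ : (0 : ℝ) < Fintype.card Ω := by exact_mod_cast Fintype.card_pos
  set μ := ProbabilityTheory.uniformOn (Set.univ : Set Ω) with hμ
  have hb : ∀ i, μ.real (bad i) = (bad i).card / Fintype.card Ω := by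
    intro i
    rw [MeasureTheory.measureReal_def, hμ, ProbabilityTheory.uniformOn_univ,
      MeasureTheory.Measure.count_apply_finset, ENNReal.toReal_div]
    simp
  have hcompl : μ.real sᶜ ≤ 1 / 100 := by
    have hsub : sᶜ ⊆ ⋃ i, (bad i : Set Ω) := by
      intro ω hω
      by_contra hnot
      simp only [Set.mem_iUnion, Finset.mem_coe, not_exists] at hnot
      exact hω (hs ω hnot)
    refine (MeasureTheory.measureReal_mono hsub).trans
      ((MeasureTheory.measureReal_iUnion_fintype_le _).trans ?_)
    rcases Nat.eq_zero_or_pos n with rfl | hn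
    · simp
    · have hn' : (0 : ℝ) < n := by exact_mod_cast hn
      calc ∑ i, μ.real (bad i) ≤ ∑ _i : Fin n, 1 / (100 * (n : ℝ)) := by
            refine Finset.sum_le_sum fun i _ => ?_
            rw [hb, div_le_div_iff₀ hΩ (by positivity), one_mul]
            exact_mod_cast hbad i
        _ = 1 / 100 := by
            rw [Finset.sum_const, Finset.card_univ, Fintype.card_fin, nsmul_eq_mul]
            field_simp
  have hadd := MeasureTheory.probReal_add_probReal_compl (μ := μ) s.toFinite.measurableSet
  linarith

/-- For `c = 8 / log 2`, the number `2 ^ rounds` is at least `n ^ 8`. -/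
theorem mul_le_two_pow_rounds {n : ℕ} (hn : 2 ≤ n) :
    100 * n ≤ 2 ^ rounds (8 / Real.log 2) n := by
  have hn0 : (0 : ℝ) < n := by positivity
  have h2 : (2 : ℝ) ≤ n := by exact_mod_cast hn
  have h1 : (n : ℝ) ^ 8 ≤ 2 ^ rounds (8 / Real.log 2) n := by
    rw [← Real.rpow_natCast 2, ← Real.log_le_log_iff (by positivity) (by positivity),
      Real.log_pow, Real.log_rpow two_pos]
    have hl := Real.log_pos one_lt_two
    have := Nat.le_ceil (8 / Real.log 2 * Real.log n)
    calc ((8 : ℕ) : ℝ) * Real.log n = 8 / Real.log 2 * Real.log n * Real.log 2 := by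
          push_cast
          field_simp
      _ ≤ _ := by
          rw [rounds]
          gcongr
  have h3 : (100 : ℝ) ≤ (n : ℝ) ^ 7 :=
    le_trans (by norm_num) (pow_le_pow_left₀ (by norm_num) h2 7)
  have h4 : (100 * n : ℝ) ≤ 2 ^ rounds (8 / Real.log 2) n := by
    calc (100 * n : ℝ) ≤ (n : ℝ) ^ 7 * n := by gcongr
      _ = (n : ℝ) ^ 8 := by ring
      _ ≤ _ := h1
  exact_mod_cast h4

end

theorem mainTheorem2 (p cU κ : ℝ) (hp : 0 < p) (hcU : 1 ≤ cU) (hκ : 1 ≤ κ) :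
    ∃ c θ : ℝ, 0 < c ∧ 0 < θ ∧
      (∃ C : ℝ, 0 < C ∧
        ∀ M : ℝ≥0 → ℝ≥0, IsMLoss M p cU →
        ∀ (n d : ℕ) (A : Matrix (Fin n) (Fin d) ℝ) (τ : ℝ), 1 ≤ τ → τ ≤ n →
        ∀ L : LewisRoutine d, L.Approximates p κ n →
          99 / 100 ≤ (ProbabilityTheory.uniformOn (Set.univ : Set (HashSeed c n τ))).real
            {ω | (∀ i, mSensitivity M p A i ≤ (sensitivityBounds p c θ L A τ ω).val i) ∧
              ∑ i, (sensitivityBounds p c θ L A τ ω).val i ≤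
                C * ((d : ℝ) ^ max 1 (p / 2) * Real.log n ^ 2 + τ)}) ∧
      (∀ c₀ : ℝ, 0 < c₀ → ∃ C : ℝ, 0 < C ∧
        ∀ (n d : ℕ) (A : Matrix (Fin n) (Fin d) ℝ) (τ : ℝ), 2 ≤ n → n ≤ nnz A → 1 ≤ τ → τ ≤ n →
        ∀ (L : LewisRoutine d) (T : ℝ), 0 ≤ T → L.RunsIn c₀ T n →
        ∀ ω : HashSeed c n τ,
          ((sensitivityBounds p c θ L A τ ω).time : ℝ) ≤
            C * ((nnz A : ℝ) * Real.log n ^ 3 + (n : ℝ) * T / τ * Real.log n)) := by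
  have hc : 0 < 8 / Real.log 2 := div_pos (by norm_num) (Real.log_pos one_lt_two)
  have hθ : 0 < 1 / (κ * (1 + cU)) := by positivity
  refine ⟨8 / Real.log 2, 1 / (κ * (1 + cU)), hc, hθ, ?_,
    fun c₀ hc₀ => exists_sensitivityBounds_time_le p _ hc hc₀⟩
  obtain ⟨C, hC, hsum⟩ := exists_sum_sensitivityBounds_le hp hc hθ (zero_lt_one.trans_le hκ)
  refine ⟨C, hC, fun M hM n d A τ h1 h2 L hL => ?_⟩
  classical
  have : Nonempty (HashSeed (8 / Real.log 2) n τ) :=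
    ⟨fun r _ _ => ⟨0, by positivity⟩⟩
  refine uniformOn_real_ge_of_union (fun i => Finset.univ.filter fun ω =>
    (sensitivityBounds p (8 / Real.log 2) (1 / (κ * (1 + cU))) L A τ ω).val i <
      mSensitivity M p A i) (fun ω hω => ⟨fun i => ?_, hsum n d A τ h1 h2 L hL ω⟩) fun i => ?_
  · simpa using hω i
  · rcases le_or_gt (mSensitivity M p A i) (2 * τ / n) with hi | hi
    · rw [Finset.filter_false_of_mem]
      · simp
      · exact fun ω _ => not_lt.2 (hi.trans (initial_le_sensitivityBounds ω i))
    -- A sensitivity is at most `1`, so it can exceed the initial bound only for `n ≥ 2`.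
    · have hn : 2 ≤ n := by
        have hn0 : (0 : ℝ) < n := by linarith
        have h3 := hi.trans_le (mSensitivity_le_one hp)
        rw [div_lt_one hn0] at h3
        have : (2 : ℝ) < n := by linarith
        exact_mod_cast this.le
      obtain ⟨r, X, hX, hbad⟩ := exists_level hM hκ hL h1 h2 hi
      refine (Nat.mul_le_mul_left _ (mul_le_two_pow_rounds hn)).trans
        (card_forall_mem_mul_le hX fun ω hω => hbad ω (by simpa using hω))
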